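/- There are absolute constants $a,k\in\mathbb N$ such that for every $\beta\in\mathbb N$ there is $\beta'\in\mathbb N$ for which the following holds. Let $G=(V,E)$ be a finite simple graph on $n$ vertices, and let $\mathcal C$ be a $(d,c)$-cycle cover of $G$, that is, a finite collection of simple cycles of $G$, each of length at most $d$, such that every edge of $G$ lies on at least one and at most $c$ cycles of $\mathcal C$. The graph and the cover are known from a preprocessing phase. In the CONGEST model with bandwidth $B$, in each synchronous round every node sends to each of its neighbours a (possibly empty) message of at most $B$ bits, computed from its local state, and then updates its state; local computation is free. Every node initially holds local data: its input and its private random coins. Then there is an integer $T\le a\,(d+c)\,\lceil\log_2 n\rceil^{k}$, i.e. $T=\widetilde O(d+c)$, such that for every $r$ there is a compiler that rewrites the program of each node separately (the new program of $v$ depends only on $G$, $\mathcal C$, $r$, $v$ and the old program of $v$), gives each node finitely many additional private fair coins, independent over the nodes, and turns every $r$-round algorithm $\mathcal A$ on $G$ with bandwidth $\beta\lceil\log_2 n\rceil$ into an $rT$-round algorithm $\mathcal A'$ on $G$ with bandwidth $\beta'\lceil\log_2 n\rceil$ such that: 1. (Equivalence.) For all inputs, all coins of $\mathcal A$ and all outcomes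 of the additional coins, every node has the same output after $rT$ rounds of $\mathcal A'$ as after $r$ rounds of $\mathcal A$. 2. (Perfect security.) Consider any eavesdropper that in each round listens to one edge of $G$, chosen as an arbitrary function of what it has seen in earlier rounds, and sees the messages sent over that edge in both directions. The distribution, over the additional coins, of everything it sees during the $rT$ rounds of $\mathcal A'$ is the same for all inputs and all coins of $\mathcal A$. Hence it learns nothing, in the information-theoretic sense, about the inputs, the messages or the outputs of $\mathcal A$. -/

import Mathlib

namespace Congest

/-- A message of at most `b` bits; the empty string stands for silence. -/
abbrev Msg (b : ℕ) : Type := {l : List Bool // l.length ≤ b}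

/-- The number of bits per edge, direction and round in the CONGEST model on `n` nodes, where
messages have size `O(log n)` and the constant of the `O` is `β`. -/
def bandwidth (β n : ℕ) : ℕ := β * Nat.clog 2 n

/-- The program run by one node. `N` is the set of its neighbours, `X` the type of the data that it
holds at the beginning, `Y` the type of its output. In every round the node sends to each neighbour
a message of at most `b` bits, computed from its state, and then computes its new state from the
old one and the messages it has received. Local computation is free. -/
structure NodeProgram (b : ℕ) (N X Y : Type) where
  State : Type
  init : X → State
  send : State → N → Msg b
  next : State → (N → Msg b) → State
  output : State → Y

variable {V : Type} {G : SimpleGraph V} {b : ℕ} {X Y : V → Type}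

/-- A distributed algorithm with bandwidth `b` on the network `G`: a program for every node. -/
abbrev Algorithm (G : SimpleGraph V) (b : ℕ) (X Y : V → Type) : Type 1 :=
  ∀ v, NodeProgram b (G.neighborSet v) (X v) (Y v)

namespace Algorithm

/-- The states of all nodes after `t` synchronous rounds of `A`, started on the local data `x`. -/
def state (A : Algorithm G b X Y) (x : ∀ v, X v) : ℕ → ∀ v, (A v).State
  | 0 => fun v => (A v).init (x v)
  | t + 1 => fun v => (A v).next (state A x t v) fun u =>
      (A u.1).send (state A x t u.1) ⟨v, G.adj_symm u.2⟩

/-- The message that is sent along the oriented edge `e` in round `t` (rounds count from `0`). -/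
def message (A : Algorithm G b X Y) (x : ∀ v, X v) (t : ℕ) (e : G.Dart) : Msg b :=
  (A e.fst).send (A.state x t e.fst) ⟨e.snd, e.adj⟩

/-- The output of node `v` when `A` is run for `r` rounds. -/
def result (A : Algorithm G b X Y) (x : ∀ v, X v) (r : ℕ) (v : V) : Y v :=
  (A v).output (A.state x r v)

end Algorithm

/-- What an eavesdropper sees in one round: the edge it listens to (given by one of its two
orientations), the message sent along it in that orientation, and the message sent along it in
the opposite orientation. -/
abbrev Observation (G : SimpleGraph V) (b : ℕ) : Type := G.Dart × Msg b × Msg b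

/-- An adaptive eavesdropper: it picks the edge to listen to in the current round as an arbitrary
function of all it has seen so far (latest observation first). -/
abbrev Eavesdropper (G : SimpleGraph V) (b : ℕ) : Type := List (Observation G b) → G.Dart

/-- All that the eavesdropper `E` has seen in the first `t` rounds of `A`, latest round first. -/
def view (A : Algorithm G b X Y) (x : ∀ v, X v) (E : Eavesdropper G b) :
    ℕ → List (Observation G b)
  | 0 => []
  | t + 1 =>
      let h := view A x E t
      (E h, A.message x t (E h), A.message x t (E h).symm) :: h

/-- The distribution of the view of `E` in the first `t` rounds of `A`, when the initial data of
node `v` are `x v` together with `m` private fair coin tosses of `v`, independent over all nodes. -/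
noncomputable def viewLaw [Fintype V] [DecidableEq V] {m : ℕ}
    (A : Algorithm G b (fun v => X v × (Fin m → Bool)) Y) (x : ∀ v, X v)
    (E : Eavesdropper G b) (t : ℕ) : PMF (List (Observation G b)) :=
  (PMF.uniformOfFintype (V → Fin m → Bool)).map fun κ => view A (fun v => (x v, κ v)) E t

/-- A compiler for the network `G`: it turns the program of a node `v`, with bandwidth `b`, into a
program of `v` with bandwidth `b'` that has the same initial data and `m` additional private fair
coin tosses. The new program of `v` depends on `G` and on the old program of `v` only, and not on
the programs or the data of other nodes. -/
abbrev Compiler (G : SimpleGraph V) (b b' m : ℕ) : Type 1 :=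
  ∀ (v : V) {X Y : Type}, NodeProgram b (G.neighborSet v) X Y →
    NodeProgram b' (G.neighborSet v) (X × (Fin m → Bool)) Y

/-- The algorithm that results from compiling the program of every node. -/
def Compiler.compile {b' m : ℕ} (K : Compiler G b b' m) (A : Algorithm G b X Y) :
    Algorithm G b' (fun v => X v × (Fin m → Bool)) Y :=
  fun v => K v (A v)

/-- `𝒞` is a `(d, c)`-cycle cover of `G`: a collection of simple cycles of length at most `d` such
that every edge of `G` is on at least one and at most `c` of them. -/
structure IsCycleCover [DecidableEq V] (G : SimpleGraph V) (𝒞 : Finset (Σ v, G.Walk v v))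
    (d c : ℕ) : Prop where
  isCycle : ∀ C ∈ 𝒞, C.2.IsCycle
  length_le : ∀ C ∈ 𝒞, C.2.length ≤ d
  covers : ∀ e ∈ G.edgeSet, 1 ≤ (𝒞.filter fun C => e ∈ C.2.edges).card
  congestion_le : ∀ e ∈ G.edgeSet, (𝒞.filter fun C => e ∈ C.2.edges).card ≤ c

end Congest

/-! Each round of the algorithm becomes a phase of `T` rounds. In a phase the message on a dart is
split additively into `T` shares and one key. The shares cross the edge directly, one per round; the
key travels from sender to receiver by a route that avoids the edge. An eavesdropper that leaves the
edge in some round of the phase misses a share. One that stays there for the whole phase never sees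
the key. In both cases some uniformly random summand stays unknown, and the message is hidden as by
a one-time pad. Formally, a change of the inputs is compensated by an injective change of the coins
that keeps the view (`exists_coin_shift`).

All keys must be routed in parallel within `T` rounds. A naive schedule on cycles of length `D` and
congestion `c'` takes about `D * c'` rounds, too many for the given cover. The cover is therefore
replaced by one with `D = O(d log² n)` and `c' = O(log² n)` (`exists_evenFamily_cover`). Its members
are sets of edges with even degrees; they split into closed trails, and these carry the keys
(`exists_trail_decomposition`, `exists_schedule`).

The new cover is built as follows. Ball growing gives clusters of radius `O(d log n)` that contain
the given cycles of at least half of the edges (`exists_clustering`). Each such edge lies on the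
fundamental cycle, with respect to a spanning tree of its cluster, of some edge. Hence for a
suitable set `F` of edges the mod 2 sum of their fundamental cycles contains at least half of these
edges (`exists_subset_half_odd`). That sum must be split into small pieces of low congestion. The
endpoints of `F` are listed in a depth-first order of the trees and cut into blocks of constant
size. The edges of `F` then form a multigraph on the blocks, which is dense enough to have cycles of
logarithmic length. Summing the fundamental cycles along such a short cycle cancels, mod 2, each
block that lies wholly below a tree edge, so only the boundedly many endpoints in blocks cut by the
subtree can put that edge into a piece (`exists_half_decomposition`). Every edge in the sum is in
some piece, so a constant fraction of the edges is covered, and logarithmically many repetitions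
cover all. -/

namespace Congest

/-! ### Combinatorial tools: odd sums, short cycles in dense multigraphs, lexicographic blocks -/

section
open scoped Classical
open Finset

theorem zmod_two_eq_one_of_ne_zero {x : ZMod 2} (h : x ≠ 0) : x = 1 := by
  revert x; decide

/-- A suitable subfamily of `F` has an odd sum in at least half of the coordinates in `U`. -/
theorem exists_subset_half_odd {α ε : Type} (φ : ε → α → ZMod 2) (F : Finset ε) :
    ∀ (U : Finset α) (o : α → ZMod 2), (∀ x ∈ U, ∃ f ∈ F, φ f x ≠ 0) →
      ∃ F' ⊆ F, U.card ≤ 2 * (U.filter fun x => o x + ∑ f ∈ F', φ f x ≠ 0).card := by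
  induction F using Finset.induction_on with
  | empty =>
    intro U o h
    have : U = ∅ := eq_empty_of_forall_notMem fun x hx => by simpa using h x hx
    exact ⟨∅, subset_rfl, by simp [this]⟩
  | insert e F he ih =>
    intro U o h
    -- On `N` the choice for `e` alone decides the parity, so one of the two choices is right for at
    -- least half of `N`. On `M` the induction applies, with the contribution of `e` absorbed in the
    -- offset `o`.
    set N := U.filter fun x => ∀ f ∈ F, φ f x = 0 with hN
    set M := U.filter fun x => ¬ ∀ f ∈ F, φ f x = 0 with hM
    have hUc : N.card + M.card = U.card := card_filter_add_card_filter_not _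
    have hNe : ∀ x ∈ N, φ e x = 1 := by
      intro x hx
      rw [hN, mem_filter] at hx
      obtain ⟨f, hf, hfx⟩ := h x hx.1
      rcases mem_insert.1 hf with rfl | hf
      · exact zmod_two_eq_one_of_ne_zero hfx
      · exact absurd (hx.2 f hf) hfx
    obtain ⟨z, hz⟩ : ∃ z : Bool, N.card ≤ 2 * (N.filter fun x =>
        o x + (if z then φ e x else 0) ≠ 0).card := by
      by_contra! hcon
      have h0 := hcon false
      have h1 := hcon true
      have h2 : (N.filter fun x => o x + (if (true : Bool) then φ e x else 0) ≠ 0)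
          = N.filter fun x => ¬ (o x + (if (false : Bool) then φ e x else 0) ≠ 0) := by
        apply filter_congr
        intro x hx
        rw [hNe x hx]
        generalize o x = y
        revert y; decide
      rw [h2] at h1
      have := card_filter_add_card_filter_not (s := N)
        (fun x => o x + (if (false : Bool) then φ e x else 0) ≠ 0)
      omega
    obtain ⟨F', hF', hc⟩ := ih M (fun x => o x + if z then φ e x else 0) (by
      intro x hx
      rw [hM, mem_filter] at hx
      push Not at hx
      exact hx.2)
    refine ⟨if z then insert e F' else F', ?_, ?_⟩
    · split_ifs
      · exact insert_subset_insert _ hF'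
      · exact hF'.trans (subset_insert _ _)
    have hsum : ∀ x, o x + ∑ f ∈ (if z then insert e F' else F'), φ f x
        = (o x + if z then φ e x else 0) + ∑ f ∈ F', φ f x := by
      intro x
      split_ifs
      · rw [sum_insert (fun h => he (hF' h)), add_assoc]
      · simp
    simp only [hsum]
    have hd : (U.filter fun x => (o x + if z then φ e x else 0) + ∑ f ∈ F', φ f x ≠ 0).card
        = (N.filter fun x => (o x + if z then φ e x else 0) + ∑ f ∈ F', φ f x ≠ 0).card
        + (M.filter fun x => (o x + if z then φ e x else 0) + ∑ f ∈ F', φ f x ≠ 0).card := by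
      rw [hN, hM, ← card_filter_add_card_filter_not (fun x => ∀ f ∈ F, φ f x = 0)]
      congr 2
      · exact filter_comm _ _ _
      · exact filter_comm _ _ _
    have hNF : (N.filter fun x => (o x + if z then φ e x else 0) + ∑ f ∈ F', φ f x ≠ 0)
        = N.filter fun x => o x + (if z then φ e x else 0) ≠ 0 := by
      apply filter_congr
      intro x hx
      rw [sum_eq_zero, add_zero]
      intro f hf
      exact (mem_filter.1 hx).2 f (hF' hf)
    rw [hd, hNF]
    omega

theorem sum_symmDiff_zmod_two {ε M : Type} [AddCommGroup M] [Module (ZMod 2) M]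
    (A B : Finset ε) (f : ε → M) :
    ∑ x ∈ symmDiff A B, f x = ∑ x ∈ A, f x + ∑ x ∈ B, f x := by
  have h2 : ∀ m : M, m + m = 0 := fun m => by
    rw [← two_smul (ZMod 2) m, show (2 : ZMod 2) = 0 from rfl, zero_smul]
  have h1 : symmDiff A B = (A \ B) ∪ (B \ A) := rfl
  rw [h1, sum_union (disjoint_sdiff_sdiff), ← sum_inter_add_sum_sdiff A B,
    ← sum_inter_add_sum_sdiff B A, inter_comm B A]
  have := h2 (∑ x ∈ A ∩ B, f x)
  rw [add_add_add_comm, this, zero_add]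

/-- A multigraph with at least twice as many edges as vertices has a short cycle, here in the form
of a short nonempty set of edges that meets every vertex an even number of times. -/
theorem exists_short_even_subset {ε β : Type} (a b : ε → β) (S₀ : Finset β) (F : Finset ε)
    (ha : ∀ f ∈ F, a f ∈ S₀) (hb : ∀ f ∈ F, b f ∈ S₀) (hF : F.Nonempty)
    (hcard : 2 * S₀.card ≤ F.card) :
    ∃ C ⊆ F, C.Nonempty ∧ C.card ≤ 2 * Nat.log 2 S₀.card + 3 ∧
      ∀ y, ∑ f ∈ C, ((if a f = y then 1 else 0) + (if b f = y then 1 else 0) : ZMod 2) = 0 := by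
  set inner : Finset β → Finset ε := fun S => F.filter fun f => a f ∈ S ∧ b f ∈ S with hinner
  have hne : S₀.Nonempty := by
    obtain ⟨f, hf⟩ := hF
    exact ⟨_, ha f hf⟩
  -- In a minimal dense vertex set, every nonempty `X` touches at least `2 * X.card` edges;
  -- otherwise removing `X` would leave a smaller dense set.
  obtain ⟨S, hS, hSmin⟩ := exists_min_image
    (S₀.powerset.filter fun S => S.Nonempty ∧ 2 * S.card ≤ (inner S).card) card
    ⟨S₀, by
      simp only [mem_filter, mem_powerset, subset_rfl, true_and, hne]
      rw [show inner S₀ = F from filter_true_of_mem fun f hf => ⟨ha f hf, hb f hf⟩]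
      exact hcard⟩
  simp only [mem_filter, mem_powerset] at hS hSmin
  obtain ⟨hSS, hSne, hSc⟩ := hS
  have htouch : ∀ X ⊆ S, X.Nonempty →
      2 * X.card ≤ ((inner S).filter fun f => a f ∈ X ∨ b f ∈ X).card := by
    intro X hX hXne
    by_cases hXS : (S \ X).Nonempty
    · have hlt : (S \ X).card < S.card :=
        card_lt_card (sdiff_ssubset hX hXne)
      have h1 : (inner (S \ X)).card < 2 * (S \ X).card := by
        by_contra! hcon
        have := hSmin (S \ X) ⟨sdiff_subset.trans hSS, hXS, hcon⟩
        omega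
      have h2 : inner (S \ X) = (inner S).filter fun f => ¬ (a f ∈ X ∨ b f ∈ X) := by
        ext f
        simp only [hinner, mem_filter, mem_sdiff]
        tauto
      have h3 := card_filter_add_card_filter_not (s := inner S) (fun f => a f ∈ X ∨ b f ∈ X)
      rw [← h2] at h3
      have h4 := card_sdiff_add_card_eq_card hX
      omega
    · have : X = S := by
        rw [not_nonempty_iff_eq_empty, sdiff_eq_empty_iff_subset] at hXS
        exact subset_antisymm hX hXS
      subst this
      rwa [filter_true_of_mem]
      intro f hf
      exact Or.inl (mem_filter.1 hf).2.1
  by_contra! hcon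
  set bd : Finset ε → β → ZMod 2 := fun C y =>
    ∑ f ∈ C, ((if a f = y then 1 else 0) + (if b f = y then 1 else 0) : ZMod 2) with hbd
  have hshort : ∀ C ⊆ F, C.card ≤ 2 * Nat.log 2 S₀.card + 3 → (∀ y, bd C y = 0) → C = ∅ := by
    intro C hC hcard hz
    by_contra hne
    obtain ⟨y, hy⟩ := hcon C hC (nonempty_of_ne_empty hne) hcard
    exact hy (hz y)
  obtain ⟨v, hv⟩ := hSne
  -- Breadth-first search from `v`: `B` is the set of vertices found, `R` the tree edges, `τ x` the
  -- tree path from `v` to `x`, described by its boundary mod 2. Without short even sets `B` doubles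
  -- in size at each step and outgrows `S₀`.
  have key : ∀ r, r ≤ Nat.log 2 S₀.card + 1 → ∃ (B : Finset β) (R : Finset ε) (τ : β → Finset ε),
      B ⊆ S ∧ R ⊆ inner S ∧ 2 ^ r ≤ B.card ∧ R.card < B.card ∧ ∀ x ∈ B, τ x ⊆ R ∧ (τ x).card ≤ r ∧
        ∀ y, bd (τ x) y = (if x = y then 1 else 0) + (if v = y then 1 else 0) := by
    intro r
    induction r with
    | zero =>
      intro _
      refine ⟨{v}, ∅, fun _ => ∅, by simpa using hv, by simp, by simp, by simp, ?_⟩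
      intro x hx
      rw [mem_singleton] at hx
      subst hx
      refine ⟨by simp, by simp, fun y => ?_⟩
      simp only [hbd, sum_empty]
      split_ifs <;> rfl
    | succ r ih =>
      intro hr
      obtain ⟨B, R, τ, hBS, hRS, hBc, hRc, hτ⟩ := ih (by omega)
      set N := (S \ B).filter fun y => ∃ f ∈ inner S, ∃ x ∈ B, ∀ z,
        bd {f} z = (if x = z then 1 else 0) + (if y = z then 1 else 0) with hN
      have hNex : ∀ y, ∃ f x, y ∈ N → f ∈ inner S ∧ x ∈ B ∧ ∀ z,
          bd {f} z = (if x = z then 1 else 0) + (if y = z then 1 else 0) := by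
        intro y
        by_cases hy : y ∈ N
        · obtain ⟨f, hf, x, hx, h⟩ := (mem_filter.1 hy).2
          exact ⟨f, x, fun _ => ⟨hf, hx, h⟩⟩
        · obtain ⟨f, hf⟩ := hF
          exact ⟨f, v, fun h => absurd h hy⟩
      choose ed nb hen using hNex
      have hdisj : Disjoint B N := by
        rw [disjoint_left]
        intro y hy hyN
        exact (mem_sdiff.1 (mem_filter.1 hyN).1).2 hy
      have hR'S : R ∪ N.image ed ⊆ inner S := by
        apply union_subset hRS
        intro f hf
        obtain ⟨y, hy, rfl⟩ := mem_image.1 hf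
        exact (hen y hy).1
      have hR' : (R ∪ N.image ed).card < (B ∪ N).card := by
        rw [card_union_of_disjoint hdisj]
        have := card_union_le R (N.image ed)
        have := card_image_le (s := N) (f := ed)
        omega
      set τ' : β → Finset ε := fun y => if y ∈ B then τ y else symmDiff {ed y} (τ (nb y)) with hτ'
      have hτ'spec : ∀ x ∈ B ∪ N, τ' x ⊆ R ∪ N.image ed ∧ (τ' x).card ≤ r + 1 ∧
          ∀ y, bd (τ' x) y = (if x = y then 1 else 0) + (if v = y then 1 else 0) := by
        intro x hx
        by_cases hxB : x ∈ B
        · obtain ⟨h1, h2, h3⟩ := hτ x hxB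
          simp only [hτ', hxB, if_true]
          exact ⟨h1.trans subset_union_left, by omega, h3⟩
        · have hxN : x ∈ N := (mem_union.1 hx).resolve_left hxB
          obtain ⟨he, hnb, hbe⟩ := hen x hxN
          obtain ⟨h1, h2, h3⟩ := hτ _ hnb
          simp only [hτ', hxB, if_false]
          refine ⟨?_, ?_, ?_⟩
          · refine (symmDiff_le_sup (a := ({ed x} : Finset ε)) (b := τ (nb x))).trans ?_
            apply union_subset
            · rw [singleton_subset_iff]
              exact mem_union_right _ (mem_image_of_mem _ hxN)
            · exact h1.trans subset_union_left
          · refine (card_le_card (symmDiff_le_sup (a := ({ed x} : Finset ε)))).trans ?_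
            refine (card_union_le _ _).trans ?_
            rw [card_singleton]
            omega
          · intro y
            have : bd (symmDiff {ed x} (τ (nb x))) y = bd {ed x} y + bd (τ (nb x)) y :=
              sum_symmDiff_zmod_two _ _ _
            rw [this, hbe, h3]
            split_ifs <;> decide
      refine ⟨B ∪ N, R ∪ N.image ed, τ', union_subset hBS
        (fun y hy => (mem_sdiff.1 (mem_filter.1 hy).1).1), hR'S, ?_, hR', hτ'spec⟩
      -- An edge at `B` outside the tree would form, with two tree paths, a nonempty even set of at
      -- most `1 + 2 * (r + 1)` edges. So all of the at least `2 * B.card` edges at `B` are tree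
      -- edges, and there are fewer tree edges than vertices in the new ball.
      have hsub : ((inner S).filter fun f => a f ∈ B ∨ b f ∈ B) ⊆ R ∪ N.image ed := by
        intro f hf
        obtain ⟨hfS, hfB⟩ := mem_filter.1 hf
        obtain ⟨hfF, haS, hbS⟩ := mem_filter.1 hfS
        have hbdf : ∀ z, bd {f} z = (if a f = z then 1 else 0) + (if b f = z then 1 else 0) :=
          fun z => by simp [hbd]
        have haB : a f ∈ B ∪ N := by
          by_cases h : a f ∈ B
          · exact mem_union_left _ h
          · refine mem_union_right _ (mem_filter.2 ⟨mem_sdiff.2 ⟨haS, h⟩, f, hfS, b f,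
              hfB.resolve_left h, fun z => ?_⟩)
            rw [hbdf, add_comm]
        have hbB : b f ∈ B ∪ N := by
          by_cases h : b f ∈ B
          · exact mem_union_left _ h
          · exact mem_union_right _ (mem_filter.2 ⟨mem_sdiff.2 ⟨hbS, h⟩, f, hfS, a f,
              hfB.resolve_right h, hbdf⟩)
        obtain ⟨ha1, ha2, ha3⟩ := hτ'spec _ haB
        obtain ⟨hb1, hb2, hb3⟩ := hτ'spec _ hbB
        by_contra hfR
        have hsubF : ∀ x ∈ B ∪ N, τ' x ⊆ F := fun x hx =>
          (hτ'spec x hx).1.trans (hR'S.trans (filter_subset _ _))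
        have hC := hshort (symmDiff {f} (symmDiff (τ' (a f)) (τ' (b f)))) ?_ ?_ ?_
        · have hmem : f ∈ symmDiff {f} (symmDiff (τ' (a f)) (τ' (b f))) := by
            rw [mem_symmDiff]
            refine Or.inl ⟨mem_singleton_self _, fun h => ?_⟩
            rcases mem_symmDiff.1 h with h | h
            · exact hfR (ha1 h.1)
            · exact hfR (hb1 h.1)
          rw [hC] at hmem
          exact absurd hmem (notMem_empty _)
        · refine (symmDiff_le_sup (a := ({f} : Finset ε))).trans (union_subset (by simpa using hfF) ?_)
          exact (symmDiff_le_sup (a := τ' (a f))).trans (union_subset (hsubF _ haB) (hsubF _ hbB))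
        · have h1 := card_le_card (symmDiff_le_sup (a := ({f} : Finset ε))
            (b := symmDiff (τ' (a f)) (τ' (b f))))
          have h2 := card_le_card (symmDiff_le_sup (a := τ' (a f)) (b := τ' (b f)))
          have h3 := h1.trans (card_union_le _ _)
          have h4 := h2.trans (card_union_le _ _)
          rw [card_singleton] at h3
          omega
        · intro y
          have e1 : bd (symmDiff {f} (symmDiff (τ' (a f)) (τ' (b f)))) y
              = bd {f} y + bd (symmDiff (τ' (a f)) (τ' (b f))) y := sum_symmDiff_zmod_two _ _ _
          have e2 : bd (symmDiff (τ' (a f)) (τ' (b f))) y = bd (τ' (a f)) y + bd (τ' (b f)) y :=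
            sum_symmDiff_zmod_two _ _ _
          rw [e1, e2, hbdf, ha3, hb3]
          split_ifs <;> decide
      have hBne : B.Nonempty := by
        rw [← card_pos]
        have := Nat.two_pow_pos r
        omega
      have := htouch B hBS hBne
      have := card_le_card hsub
      rw [pow_succ]
      omega
  obtain ⟨B, R, τ, hBS, -, hB, -⟩ := key _ le_rfl
  have h1 := card_le_card (hBS.trans hSS)
  have h2 := Nat.lt_pow_succ_log_self (b := 2) (by norm_num) S₀.card
  simp only [Nat.succ_eq_add_one] at h2
  omega

theorem exists_monotone_enumeration {τ κ : Type} [LinearOrder κ] (X : Finset τ) (key : τ → κ) :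
    ∃ ord : τ → ℕ, (∀ x ∈ X, ord x < X.card) ∧ Set.InjOn ord X ∧
      ∀ x ∈ X, ∀ y ∈ X, ord x ≤ ord y → key x ≤ key y := by
  set f : Fin X.card → κ := fun i => key (X.equivFin.symm i) with hf
  have hmon := Tuple.monotone_sort f
  refine ⟨fun x => if h : x ∈ X then ((Tuple.sort f).symm (X.equivFin ⟨x, h⟩) : ℕ) else 0,
    ?_, ?_, ?_⟩
  · intro x hx
    simp only [hx, dif_pos]
    exact Fin.is_lt _
  · intro x hx y hy hxy
    have hx' : x ∈ X := hx
    have hy' : y ∈ X := hy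
    simp only [hx', hy', dif_pos] at hxy
    simpa using Fin.ext hxy
  · intro x hx y hy hxy
    simp only [hx, hy, dif_pos] at hxy
    have := hmon (show (Tuple.sort f).symm (X.equivFin ⟨x, hx⟩)
      ≤ (Tuple.sort f).symm (X.equivFin ⟨y, hy⟩) from hxy)
    simpa [hf] using this

theorem cons_le_cons_iff_lt_or {κ : Type} [LinearOrder κ] {a b : κ} {l m : List κ} :
    a :: l ≤ b :: m ↔ a < b ∨ a = b ∧ l ≤ m := by
  rw [le_iff_lt_or_eq, le_iff_lt_or_eq, List.cons_lt_cons_iff, List.cons.injEq]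
  tauto

/-- The lists with a given prefix form an interval in the lexicographic order. For root paths this
makes every subtree an interval. -/
theorem prefix_of_le_of_le {κ : Type} [LinearOrder κ] {p l m l' : List κ} (hl : p <+: l)
    (hl' : p <+: l') (h : l ≤ m) (h' : m ≤ l') : p <+: m := by
  induction p generalizing l m l' with
  | nil => exact List.nil_prefix
  | cons c p ih =>
    obtain ⟨t, rfl⟩ := hl
    obtain ⟨t', rfl⟩ := hl'
    cases m with
    | nil => exact absurd h (by simp)
    | cons x m =>
      simp only [List.cons_append] at h h'
      rw [cons_le_cons_iff_lt_or] at h h'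
      have hcx : c = x := by
        rcases h with h | h <;> rcases h' with h' | h'
        · exact absurd (h.trans h') (lt_irrefl _)
        · exact h'.1.symm
        · exact h.1
        · exact h.1
      subst hcx
      simp only [lt_self_iff_false, true_and, false_or] at h h'
      rw [List.cons_prefix_cons]
      exact ⟨rfl, ih (List.prefix_append _ _) (List.prefix_append _ _) h h'⟩

/-- Cut the tokens of `X`, in the lexicographic order of their keys, into blocks of `s` tokens.
Then few tokens with a given prefix are in a block that has also tokens without that prefix. -/
theorem exists_blocks {τ κ : Type} [LinearOrder κ] (X : Finset τ) (key : τ → List κ)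
    {s : ℕ} (hs : 0 < s) :
    ∃ blk : τ → ℕ, (∀ x ∈ X, blk x ≤ (X.card - 1) / s) ∧ ∀ p : List κ,
      (X.filter fun x => p <+: key x ∧ ∃ y ∈ X, blk y = blk x ∧ ¬ p <+: key y).card ≤ 2 * s := by
  obtain ⟨ord, hlt, hinj, hmon⟩ := exists_monotone_enumeration X key
  refine ⟨fun x => ord x / s, fun x hx => Nat.div_le_div_right (by have := hlt x hx; omega), ?_⟩
  intro p
  have hfib : ∀ k, (X.filter fun x => ord x / s = k).card ≤ s := by
    intro k
    have : ((X.filter fun x => ord x / s = k).image ord) ⊆ Ico (s * k) (s * k + s) := by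
      intro i hi
      obtain ⟨x, hx, rfl⟩ := mem_image.1 hi
      have h1 := (mem_filter.1 hx).2
      rw [mem_Ico, ← h1]
      have h2 := Nat.div_add_mod (ord x) s
      have h3 := Nat.mod_lt (ord x) hs
      omega
    have h := card_le_card this
    rw [card_image_of_injOn (hinj.mono (by intro x; simp +contextual)), Nat.card_Ico] at h
    omega
  -- The tokens with prefix `p` are an interval. The tokens in `up` share the block at its upper
  -- end, those in `dn` the block at its lower end.
  set up := X.filter fun x => p <+: key x ∧ ∃ y ∈ X, ord y / s = ord x / s ∧ ord x ≤ ord y ∧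
    ¬ p <+: key y with hup
  set dn := X.filter fun x => p <+: key x ∧ ∃ y ∈ X, ord y / s = ord x / s ∧ ord y ≤ ord x ∧
    ¬ p <+: key y with hdn
  have hupc : up.card ≤ s := by
    rcases up.eq_empty_or_nonempty with h | ⟨x, hx⟩
    · simp [h]
    · refine (card_le_card ?_).trans (hfib (ord x / s))
      have aux : ∀ x ∈ up, ∀ x' ∈ up, ord x ≤ ord x' → ord x' / s = ord x / s := by
        intro x hx x' hx' hle
        obtain ⟨hxX, hpx, y, hy, hyb, hxy, hpy⟩ := mem_filter.1 hx
        obtain ⟨hxX', hpx', -⟩ := mem_filter.1 hx'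
        have h1 : ord x' ≤ ord y := by
          by_contra! hcon
          exact hpy (prefix_of_le_of_le hpx hpx' (hmon _ hxX _ hy hxy)
            (hmon _ hy _ hxX' hcon.le))
        have h2 := Nat.div_le_div_right (c := s) hle
        have h3 := Nat.div_le_div_right (c := s) h1
        omega
      intro x' hx'
      refine mem_filter.2 ⟨(mem_filter.1 hx').1, ?_⟩
      rcases le_total (ord x) (ord x') with h | h
      · exact aux x hx x' hx' h
      · exact (aux x' hx' x hx h).symm
  have hdnc : dn.card ≤ s := by
    rcases dn.eq_empty_or_nonempty with h | ⟨x, hx⟩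
    · simp [h]
    · refine (card_le_card ?_).trans (hfib (ord x / s))
      have aux : ∀ x ∈ dn, ∀ x' ∈ dn, ord x ≤ ord x' → ord x' / s = ord x / s := by
        intro x hx x' hx' hle
        obtain ⟨hxX', hpx', y, hy, hyb, hxy, hpy⟩ := mem_filter.1 hx'
        obtain ⟨hxX, hpx, -⟩ := mem_filter.1 hx
        have h1 : ord y ≤ ord x := by
          by_contra! hcon
          exact hpy (prefix_of_le_of_le hpx hpx' (hmon _ hxX _ hy hcon.le)
            (hmon _ hy _ hxX' hxy))
        have h2 := Nat.div_le_div_right (c := s) hle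
        have h3 := Nat.div_le_div_right (c := s) h1
        omega
      intro x' hx'
      refine mem_filter.2 ⟨(mem_filter.1 hx').1, ?_⟩
      rcases le_total (ord x) (ord x') with h | h
      · exact aux x hx x' hx' h
      · exact (aux x' hx' x hx h).symm
  have hsub : (X.filter fun x => p <+: key x ∧ ∃ y ∈ X, ord y / s = ord x / s ∧ ¬ p <+: key y)
      ⊆ up ∪ dn := by
    intro x hx
    obtain ⟨hxX, hp, y, hy, hb, hpy⟩ := mem_filter.1 hx
    rcases le_total (ord x) (ord y) with h | h
    · exact mem_union_left _ (mem_filter.2 ⟨hxX, hp, y, hy, hb, h, hpy⟩)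
    · exact mem_union_right _ (mem_filter.2 ⟨hxX, hp, y, hy, hb, h, hpy⟩)
  refine ((card_le_card hsub).trans (card_union_le _ _)).trans ?_
  omega

end

/-! ### Fundamental cycles of a rooted forest and their grouping into pieces of low congestion -/

section
open scoped Classical
open Finset

variable {V : Type} {G : SimpleGraph V}

/-- The number, mod 2, of the edges at `y` in an edge set given by its indicator. -/
noncomputable def degreeMod [Fintype V] (x : Sym2 V → ZMod 2) (y : V) : ZMod 2 := ∑ e, if y ∈ e then x e else 0

theorem degreeMod_add [Fintype V] (x x' : Sym2 V → ZMod 2) (y : V) :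
    degreeMod (x + x') y = degreeMod x y + degreeMod x' y := by
  simp only [degreeMod, ← sum_add_distrib, Pi.add_apply]
  refine sum_congr rfl fun e _ => ?_
  split_ifs <;> simp

/-- A rooted spanning forest of `G`: `path u` lists the vertices from the root of `u` to `u`. -/
structure RootedForest (G : SimpleGraph V) where
  path : V → List V
  parent : V → V
  spec : ∀ u, path u = [u] ∨ G.Adj (parent u) u ∧ path u = path (parent u) ++ [u]

namespace RootedForest

variable (T : RootedForest G)

theorem self_mem_path (u : V) : u ∈ T.path u := by
  rcases T.spec u with h | ⟨-, h⟩ <;> rw [h] <;> simp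

theorem path_parent_ne_nil (u : V) : T.path (T.parent u) ≠ [] :=
  List.ne_nil_of_mem (T.self_mem_path _)

theorem path_induction {p : V → Prop} (root : ∀ u, T.path u = [u] → p u)
    (step : ∀ u, G.Adj (T.parent u) u → T.path u = T.path (T.parent u) ++ [u] →
      p (T.parent u) → p u) (u : V) : p u := by
  induction hn : (T.path u).length using Nat.strong_induction_on generalizing u with
  | _ n ih =>
    rcases T.spec u with h | ⟨ha, h⟩
    · exact root u h
    · refine step u ha h (ih _ ?_ _ rfl)
      rw [← hn, h]
      simp

/-- Being an ancestor becomes a prefix relation, which is what the lexicographic order of root paths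
detects. -/
theorem mem_path_iff {u v : V} : v ∈ T.path u ↔ T.path v <+: T.path u := by
  refine ⟨fun h => ?_, fun h => h.subset (T.self_mem_path v)⟩
  induction u using T.path_induction with
  | root u hu =>
    rw [hu, List.mem_singleton] at h
    subst h
    exact List.prefix_rfl
  | step u ha hu ih =>
    rw [hu, List.mem_append, List.mem_singleton] at h
    rcases h with h | rfl
    · rw [hu]
      exact (ih h).trans (List.prefix_append _ _)
    · exact List.prefix_rfl

theorem nodup_path (u : V) : (T.path u).Nodup := by
  induction u using T.path_induction with
  | root u hu => rw [hu]; exact List.nodup_singleton u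
  | step u ha hu ih =>
    rw [hu]
    refine List.Nodup.append ih (List.nodup_singleton u) ?_
    rw [List.disjoint_singleton]
    intro h
    have := (T.mem_path_iff.1 h).length_le
    rw [hu] at this
    simp at this

/-- The indicator of the edge from `v` to its parent, zero at the roots. -/
noncomputable def parentEdge (v : V) : Sym2 V → ZMod 2 :=
  if T.path v = [v] then 0 else Pi.single s(T.parent v, v) 1

theorem parentEdge_ne_zero {v : V} {e : Sym2 V} (h : T.parentEdge v e ≠ 0) :
    e = s(T.parent v, v) ∧ e ∈ G.edgeSet := by
  unfold parentEdge at h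
  split_ifs at h with hv
  · simp at h
  · have : e = s(T.parent v, v) := by
      by_contra hne
      exact h (Pi.single_eq_of_ne hne _)
    exact ⟨this, by rw [this]; exact ((T.spec v).resolve_left hv).1⟩

/-- The indicator of the set of edges on the path from `u` to its root. -/
noncomputable def pathVec (u : V) : Sym2 V → ZMod 2 := ((T.path u).map T.parentEdge).sum

theorem pathVec_of_root {u : V} (h : T.path u = [u]) : T.pathVec u = 0 := by
  simp [pathVec, h, parentEdge]

theorem pathVec_of_ne {u : V} (h : T.path u = T.path (T.parent u) ++ [u]) :
    T.pathVec u = T.pathVec (T.parent u) + Pi.single s(T.parent u, u) 1 := by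
  have hu : T.path u ≠ [u] := by
    rw [h]
    intro h'
    exact T.path_parent_ne_nil u (by simpa using h')
  rw [pathVec, h, List.map_append, List.sum_append, pathVec]
  simp [parentEdge, hu]

/-- The mod 2 sum of `f` and the paths from its endpoints to their roots. -/
noncomputable def fundamental (f : Sym2 V) : Sym2 V → ZMod 2 :=
  Pi.single f 1 + Sym2.lift ⟨fun a b => T.pathVec a + T.pathVec b, fun _ _ => add_comm _ _⟩ f

theorem fundamental_mk (a b : V) :
    T.fundamental s(a, b) = Pi.single s(a, b) 1 + (T.pathVec a + T.pathVec b) := rfl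

/-- One of the two endpoints of an edge. -/
noncomputable def endpoint (x : Sym2 V × Bool) : V :=
  if x.2 then (Quot.out x.1).1 else (Quot.out x.1).2

theorem mk_endpoint (f : Sym2 V) : s(endpoint (f, true), endpoint (f, false)) = f := by
  simp only [endpoint, if_true, Bool.false_eq_true, if_false]
  exact Quot.out_eq f

theorem fundamental_eq (f : Sym2 V) : T.fundamental f =
    Pi.single f 1 + (T.pathVec (endpoint (f, true)) + T.pathVec (endpoint (f, false))) := by
  conv_lhs => rw [← mk_endpoint f, fundamental_mk, mk_endpoint]

/-- The mod 2 sum of the `fundamental` vectors of the edges in `C`. -/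
noncomputable def span (C : Finset (Sym2 V)) : Sym2 V → ZMod 2 := ∑ f ∈ C, T.fundamental f

theorem pathVec_eq_sum (u : V) (e : Sym2 V) :
    T.pathVec u e = ((T.path u).map fun v => T.parentEdge v e).sum := by
  rw [pathVec]
  induction T.path u with
  | nil => rfl
  | cons v l ih => rw [List.map_cons, List.sum_cons, List.map_cons, List.sum_cons, ← ih]; rfl

theorem pathVec_ne_zero {u : V} {e : Sym2 V} (h : T.pathVec u e ≠ 0) :
    ∃ v ∈ T.path u, T.parentEdge v e ≠ 0 := by
  by_contra! hcon
  apply h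
  rw [pathVec_eq_sum]
  apply List.sum_eq_zero
  intro x hx
  obtain ⟨v, hv, rfl⟩ := List.mem_map.1 hx
  exact hcon v hv

theorem span_biUnion {𝓕 : Finset (Finset (Sym2 V))}
    (h : (𝓕 : Set (Finset (Sym2 V))).PairwiseDisjoint id) :
    T.span (𝓕.biUnion id) = ∑ C ∈ 𝓕, T.span C :=
  sum_biUnion h

variable [Fintype V]

theorem pathVec_apply (u : V) (e : Sym2 V) :
    T.pathVec u e = ∑ v, if v ∈ T.path u then T.parentEdge v e else 0 := by
  rw [pathVec_eq_sum, ← List.sum_toFinset _ (T.nodup_path u),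
    ← sum_filter]
  apply sum_congr
  · ext; simp
  · intros; rfl

/-- Each endpoint of an edge in `C` is a token that contributes its root path, so the edge above `v`
occurs once for every token below `v`, and only the parity of their number counts. -/
theorem span_apply (C : Finset (Sym2 V)) (e : Sym2 V) :
    T.span C e = (if e ∈ C then 1 else 0) + ∑ v, (∑ x ∈ C ×ˢ (univ : Finset Bool),
      if v ∈ T.path (endpoint x) then 1 else 0) * T.parentEdge v e := by
  have h1 : ∀ f, T.fundamental f e = (Pi.single f 1 : Sym2 V → ZMod 2) e +
      ∑ v, ∑ z : Bool, (if v ∈ T.path (endpoint (f, z)) then 1 else 0) * T.parentEdge v e := by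
    intro f
    rw [fundamental_eq, Pi.add_apply, Pi.add_apply, pathVec_apply, pathVec_apply,
      ← sum_add_distrib]
    simp
  rw [span, Finset.sum_apply]
  simp only [h1]
  rw [sum_add_distrib, sum_comm]
  congr 1
  · simp [Pi.single_apply]
  · refine sum_congr rfl fun v _ => ?_
    rw [sum_product, sum_mul]
    refine sum_congr rfl fun f _ => ?_
    rw [sum_mul]

theorem span_ne_zero_mem_edgeSet {C : Finset (Sym2 V)} (hC : ∀ f ∈ C, f ∈ G.edgeSet)
    {e : Sym2 V} (h : T.span C e ≠ 0) : e ∈ G.edgeSet := by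
  rw [span_apply] at h
  by_contra he
  apply h
  rw [if_neg (fun h => he (hC _ h)), zero_add]
  apply sum_eq_zero
  intro v _
  by_cases hv : T.parentEdge v e = 0
  · rw [hv, mul_zero]
  · exact absurd (T.parentEdge_ne_zero hv).2 he

theorem card_support_span_le {H : ℕ} (hH : ∀ u, (T.path u).length ≤ H) (C : Finset (Sym2 V)) :
    (univ.filter fun e => T.span C e ≠ 0).card ≤ C.card * (1 + 2 * H) := by
  have hsub : (univ.filter fun e => T.span C e ≠ 0) ⊆ C.biUnion fun f => {f} ∪
      ((T.path (endpoint (f, true))).toFinset ∪ (T.path (endpoint (f, false))).toFinset).image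
        (fun v => s(T.parent v, v)) := by
    intro e he
    have he := (mem_filter.1 he).2
    rw [span, Finset.sum_apply] at he
    obtain ⟨f, hf, hfe⟩ := exists_ne_zero_of_sum_ne_zero he
    refine mem_biUnion.2 ⟨f, hf, ?_⟩
    by_cases hef : e = f
    · exact mem_union_left _ (by simpa using hef)
    · apply mem_union_right
      rw [fundamental_eq, Pi.add_apply, Pi.single_eq_of_ne hef, zero_add, Pi.add_apply] at hfe
      rw [mem_image]
      by_cases h1 : T.pathVec (endpoint (f, true)) e = 0
      · rw [h1, zero_add] at hfe
        obtain ⟨v, hv, hve⟩ := T.pathVec_ne_zero hfe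
        exact ⟨v, by simp [hv], (T.parentEdge_ne_zero hve).1.symm⟩
      · obtain ⟨v, hv, hve⟩ := T.pathVec_ne_zero h1
        exact ⟨v, by simp [hv], (T.parentEdge_ne_zero hve).1.symm⟩
  refine (card_le_card hsub).trans (card_biUnion_le_card_mul _ _ _ fun f _ => ?_)
  refine (card_union_le _ _).trans ?_
  rw [card_singleton]
  have h1 := card_image_le (s := (T.path (endpoint (f, true))).toFinset ∪
    (T.path (endpoint (f, false))).toFinset) (f := fun v => s(T.parent v, v))
  have h2 := card_union_le (T.path (endpoint (f, true))).toFinset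
    (T.path (endpoint (f, false))).toFinset
  have h3 := (List.toFinset_card_le (T.path (endpoint (f, true)))).trans (hH _)
  have h4 := (List.toFinset_card_le (T.path (endpoint (f, false)))).trans (hH _)
  omega

/-- If every block has an even number of tokens of `C` and an odd number of the tokens of `C` is
below `v`, then `C` has a token below `v` in a block that is not entirely below `v`. -/
theorem exists_token_of_odd {X : Finset (Sym2 V × Bool)} {blk : Sym2 V × Bool → ℕ}
    {C : Finset (Sym2 V)} (hCX : C ×ˢ univ ⊆ X)
    (heven : ∀ k, ∑ x ∈ C ×ˢ (univ : Finset Bool), (if blk x = k then 1 else 0 : ZMod 2) = 0)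
    {v : V} (hodd : ∑ x ∈ C ×ˢ (univ : Finset Bool),
      (if v ∈ T.path (endpoint x) then 1 else 0 : ZMod 2) ≠ 0) :
    ∃ x ∈ C ×ˢ (univ : Finset Bool), v ∈ T.path (endpoint x) ∧
      ∃ y ∈ X, blk y = blk x ∧ v ∉ T.path (endpoint y) := by
  by_contra! hcon
  apply hodd
  set K := (X.image blk).filter fun k => ∀ y ∈ X, blk y = k → v ∈ T.path (endpoint y) with hK
  have h1 : ∀ x ∈ C ×ˢ (univ : Finset Bool), (if v ∈ T.path (endpoint x) then 1 else 0 : ZMod 2)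
      = ∑ k ∈ K, if blk x = k then 1 else 0 := by
    intro x hx
    rw [sum_ite_eq]
    have : v ∈ T.path (endpoint x) ↔ blk x ∈ K := by
      rw [hK, mem_filter]
      refine ⟨fun h => ⟨mem_image_of_mem _ (hCX hx), hcon x hx h⟩, fun h => h.2 x (hCX hx) rfl⟩
    simp only [this]
  rw [sum_congr rfl h1, sum_comm]
  exact sum_eq_zero fun k _ => heven k

/-- A tree edge above `v` is in `T.span C` without being in `C` only if `C` owns one of the at most
`q` tokens below `v` in a block cut by the subtree of `v`. The pieces are disjoint, so at most `q`
of them qualify. The factor 2 allows either endpoint of `e` to be the child `v`; the 1 is for the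
piece that contains `e` itself. -/
theorem card_filter_span_le {X : Finset (Sym2 V × Bool)} {blk : Sym2 V × Bool → ℕ} {q : ℕ}
    (hq : ∀ v, (X.filter fun x => v ∈ T.path (endpoint x) ∧
      ∃ y ∈ X, blk y = blk x ∧ v ∉ T.path (endpoint y)).card ≤ q)
    {𝓕 : Finset (Finset (Sym2 V))} (hX : ∀ C ∈ 𝓕, C ×ˢ univ ⊆ X)
    (hdisj : (𝓕 : Set (Finset (Sym2 V))).PairwiseDisjoint id)
    (heven : ∀ C ∈ 𝓕, ∀ k,
      ∑ x ∈ C ×ˢ (univ : Finset Bool), (if blk x = k then 1 else 0 : ZMod 2) = 0)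
    (e : Sym2 V) : (𝓕.filter fun C => T.span C e ≠ 0).card ≤ 1 + 2 * q := by
  set cut : V → Finset (Sym2 V × Bool) := fun v => X.filter fun x => v ∈ T.path (endpoint x) ∧
      ∃ y ∈ X, blk y = blk x ∧ v ∉ T.path (endpoint y) with hcut
  have huniq : ∀ C ∈ 𝓕, ∀ C' ∈ 𝓕, ∀ f, f ∈ C → f ∈ C' → C = C' := by
    intro C hC C' hC' f hf hf'
    by_contra hne
    exact disjoint_left.1 (hdisj hC hC' hne) hf hf'
  set odd : V → Finset (Finset (Sym2 V)) := fun v =>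
    𝓕.filter fun C => ∃ x ∈ cut v, x.1 ∈ C with hodd
  have hoddc : ∀ v, (odd v).card ≤ q := by
    intro v
    refine le_trans ?_ (hq v)
    refine card_le_card_of_forall_subsingleton (fun C x => x.1 ∈ C) ?_ ?_
    · intro C hC
      exact (mem_filter.1 hC).2
    · intro x _ C hC C' hC'
      exact huniq C (mem_filter.1 hC.1).1 C' (mem_filter.1 hC'.1).1 x.1 hC.2 hC'.2
  have hsub : (𝓕.filter fun C => T.span C e ≠ 0) ⊆ (𝓕.filter fun C => e ∈ C) ∪
      (odd (endpoint (e, true)) ∪ odd (endpoint (e, false))) := by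
    intro C hC
    obtain ⟨hC, hCe⟩ := mem_filter.1 hC
    by_cases he : e ∈ C
    · exact mem_union_left _ (mem_filter.2 ⟨hC, he⟩)
    · apply mem_union_right
      rw [span_apply, if_neg he, zero_add] at hCe
      obtain ⟨v, -, hv⟩ := exists_ne_zero_of_sum_ne_zero hCe
      obtain ⟨x, hx, hvx, hy⟩ := T.exists_token_of_odd (hX C hC) (heven C hC)
        (left_ne_zero_of_mul hv)
      have hCv : C ∈ odd v :=
        mem_filter.2 ⟨hC, x, mem_filter.2 ⟨hX C hC hx, hvx, hy⟩, (mem_product.1 hx).1⟩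
      have hve : v ∈ e := by
        rw [(T.parentEdge_ne_zero (right_ne_zero_of_mul hv)).1]
        simp
      rw [← mk_endpoint e, Sym2.mem_iff] at hve
      rcases hve with rfl | rfl
      · exact mem_union_left _ hCv
      · exact mem_union_right _ hCv
  have h1 : (𝓕.filter fun C => e ∈ C).card ≤ 1 := by
    rw [card_le_one]
    intro C hC C' hC'
    exact huniq C (mem_filter.1 hC).1 C' (mem_filter.1 hC').1 e (mem_filter.1 hC).2
      (mem_filter.1 hC').2
  have h2 := (card_le_card hsub).trans (card_union_le _ _)
  have h3 := card_union_le (odd (endpoint (e, true))) (odd (endpoint (e, false)))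
  have h4 := hoddc (endpoint (e, true))
  have h5 := hoddc (endpoint (e, false))
  omega

/-- At least half of `F` can be partitioned into short pieces whose spans have low congestion. -/
theorem exists_half_decomposition (F : Finset (Sym2 V)) :
    ∃ 𝓕 : Finset (Finset (Sym2 V)),
      (∀ C ∈ 𝓕, C ⊆ F ∧ C.Nonempty ∧ C.card ≤ 2 * Nat.log 2 F.card + 3) ∧
      (𝓕 : Set (Finset (Sym2 V))).PairwiseDisjoint id ∧
      F.card ≤ 2 * (𝓕.biUnion id).card ∧
      ∀ e, (𝓕.filter fun C => T.span C e ≠ 0).card ≤ 65 := by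
  -- An arbitrary numbering of the vertices, needed only to compare root paths lexicographically.
  let idx : V → ℕ := fun v => Fintype.equivFin V v
  have hidx : Function.Injective idx := fun a b h => (Fintype.equivFin V).injective (Fin.ext h)
  set X : Finset (Sym2 V × Bool) := F ×ˢ univ with hX
  have hXc : X.card = 2 * F.card := by
    rw [hX, card_product, card_univ, Fintype.card_bool, mul_comm]
  -- With 16 tokens per block there are about `F.card / 8` blocks, so more than half of `F` is still
  -- at least twice as many edges as blocks once `F.card > 8`. Then `q = 2 * 16` and the congestion
  -- is `1 + 2 * 32 = 65`.
  obtain ⟨blk, hblk, hcut⟩ := exists_blocks X (fun x => (T.path (endpoint x)).map idx)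
    (s := 16) (by norm_num)
  have hpre : ∀ v x, (T.path v).map idx <+: (T.path (endpoint x)).map idx ↔
      v ∈ T.path (endpoint x) := by
    intro v x
    rw [T.mem_path_iff]
    refine ⟨fun h => ?_, fun h => h.map _⟩
    rw [List.prefix_iff_eq_take, ← List.map_take, List.length_map] at h
    rw [List.prefix_iff_eq_take]
    exact hidx.list_map h
  have hq : ∀ v, (X.filter fun x => v ∈ T.path (endpoint x) ∧
      ∃ y ∈ X, blk y = blk x ∧ v ∉ T.path (endpoint y)).card ≤ 32 := by
    intro v
    have := hcut ((T.path v).map idx)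
    simp only [hpre] at this
    exact this
  set good : Finset (Finset (Sym2 V)) → Prop := fun 𝓕 =>
    (∀ C ∈ 𝓕, C ⊆ F ∧ C.Nonempty ∧ C.card ≤ 2 * Nat.log 2 F.card + 3 ∧
      ∀ k, ∑ x ∈ C ×ˢ (univ : Finset Bool), (if blk x = k then 1 else 0 : ZMod 2) = 0) ∧
      (𝓕 : Set (Finset (Sym2 V))).PairwiseDisjoint id with hgood
  obtain ⟨𝓕, h𝓕, hmax⟩ := exists_max_image (univ.filter good)
    (fun 𝓕 => (𝓕.biUnion id).card) ⟨∅, by simp [hgood]⟩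
  have h𝓕 := (mem_filter.1 h𝓕).2
  refine ⟨𝓕, fun C hC => ⟨(h𝓕.1 C hC).1, (h𝓕.1 C hC).2.1, (h𝓕.1 C hC).2.2.1⟩, h𝓕.2, ?_,
    T.card_filter_span_le hq (fun C hC => product_subset_product_left (h𝓕.1 C hC).1) h𝓕.2
      fun C hC => (h𝓕.1 C hC).2.2.2⟩
  -- If a maximal family missed more than half of `F`, the missed edges, seen as a multigraph on the
  -- blocks, would contain a further short even piece.
  by_contra! hlt
  have hUF : 𝓕.biUnion id ⊆ F := biUnion_subset.2 fun C hC => (h𝓕.1 C hC).1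
  set R := F \ 𝓕.biUnion id with hR
  have hRc : R.card + (𝓕.biUnion id).card = F.card := card_sdiff_add_card_eq_card hUF
  have hRF : R ⊆ F := sdiff_subset
  have hRne : R.Nonempty := card_pos.1 (by omega)
  obtain ⟨C, hCR, hCne, hCc, hCe⟩ : ∃ C ⊆ R, C.Nonempty ∧ C.card ≤ 2 * Nat.log 2 F.card + 3 ∧
      ∀ k, ∑ x ∈ C ×ˢ (univ : Finset Bool), (if blk x = k then 1 else 0 : ZMod 2) = 0 := by
    have hmemX : ∀ f ∈ R, ∀ z, (f, z) ∈ X := fun f hf z =>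
      mem_product.2 ⟨hRF hf, mem_univ _⟩
    -- Here all tokens are in block 0, every edge is a loop, and a single edge is already an even
    -- piece.
    by_cases h8 : F.card ≤ 8
    · obtain ⟨f, hf⟩ := hRne
      refine ⟨{f}, by simpa using hf, singleton_nonempty _, by simp, fun k => ?_⟩
      have hz : ∀ z, blk (f, z) = 0 := by
        intro z
        have := hblk (f, z) (hmemX f hf z)
        omega
      rw [sum_product, sum_singleton, Fintype.sum_bool, hz, hz]
      split_ifs <;> decide
    · have hmem : ∀ z, ∀ f ∈ R, blk (f, z) ∈ range ((X.card - 1) / 16 + 1) := by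
        intro z f hf
        have := hblk (f, z) (hmemX f hf z)
        rw [mem_range]
        omega
      obtain ⟨C, hCR, hCne, hCc, hCe⟩ := exists_short_even_subset (fun f => blk (f, true))
        (fun f => blk (f, false)) (range ((X.card - 1) / 16 + 1)) R (hmem true) (hmem false) hRne
        (by rw [card_range]; omega)
      refine ⟨C, hCR, hCne, hCc.trans ?_, fun k => ?_⟩
      · have := Nat.log_mono_right (b := 2)
          (show (range ((X.card - 1) / 16 + 1)).card ≤ F.card by rw [card_range]; omega)
        omega
      · rw [sum_product]
        simp only [Fintype.sum_bool]
        convert hCe k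
  have hCdisj : Disjoint C (𝓕.biUnion id) := disjoint_of_subset_left hCR sdiff_disjoint
  have hins : good (insert C 𝓕) := by
    refine ⟨?_, ?_⟩
    · intro C' hC'
      rcases mem_insert.1 hC' with rfl | h
      · exact ⟨hCR.trans hRF, hCne, hCc, hCe⟩
      · exact h𝓕.1 C' h
    · rw [coe_insert]
      refine h𝓕.2.insert fun C' hC' _ => ?_
      exact disjoint_of_subset_right (subset_biUnion_of_mem id hC') hCdisj
  have := hmax _ (mem_filter.2 ⟨mem_univ _, hins⟩)
  rw [biUnion_insert, id, card_union_of_disjoint hCdisj] at this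
  have := card_pos.2 hCne
  omega

/-- Iterated halving: each round treats at least half of what is left of `F` and adds 65 to the
congestion. -/
theorem exists_decomposition (M : ℕ) : ∀ (k : ℕ) (F : Finset (Sym2 V)), F.card ≤ M →
    F.card < 2 ^ k → ∃ 𝓕 : Finset (Finset (Sym2 V)),
      (∀ C ∈ 𝓕, C ⊆ F ∧ C.Nonempty ∧ C.card ≤ 2 * Nat.log 2 M + 3) ∧
      (𝓕 : Set (Finset (Sym2 V))).PairwiseDisjoint id ∧ 𝓕.biUnion id = F ∧
      ∀ e, (𝓕.filter fun C => T.span C e ≠ 0).card ≤ k * 65 := by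
  intro k
  induction k with
  | zero =>
    intro F _ hF
    have : F = ∅ := by
      rw [← card_eq_zero]
      simpa using hF
    subst this
    exact ⟨∅, by simp⟩
  | succ k ih =>
    intro F hM hF
    obtain ⟨𝓐, hA, hAd, hAc, hAe⟩ := T.exists_half_decomposition F
    have hUF : 𝓐.biUnion id ⊆ F := biUnion_subset.2 fun C hC => (hA C hC).1
    have hRc := card_sdiff_add_card_eq_card hUF
    rw [pow_succ] at hF
    obtain ⟨𝓑, hB, hBd, hBU, hBe⟩ := ih (F \ 𝓐.biUnion id) (by omega) (by omega)
    have hlog := Nat.log_mono_right (b := 2) hM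
    refine ⟨𝓐 ∪ 𝓑, ?_, ?_, ?_, ?_⟩
    · intro C hC
      rcases mem_union.1 hC with h | h
      · exact ⟨(hA C h).1, (hA C h).2.1, by have := (hA C h).2.2; omega⟩
      · exact ⟨(hB C h).1.trans sdiff_subset, (hB C h).2.1, (hB C h).2.2⟩
    · rw [coe_union, Set.pairwiseDisjoint_union]
      refine ⟨hAd, hBd, fun C hC C' hC' _ => ?_⟩
      exact disjoint_of_subset_left (subset_biUnion_of_mem id hC)
        (disjoint_of_subset_right (hB C' hC').1 disjoint_sdiff)
    · rw [union_biUnion, hBU]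
      exact union_sdiff_of_subset hUF
    · intro e
      rw [filter_union]
      refine (card_union_le _ _).trans ?_
      have := hAe e
      have := hBe e
      rw [add_mul]
      omega

end RootedForest
end

/-! ### Degrees mod 2, fundamental cycles along a cycle, and clustering by ball growing -/

section
open scoped Classical
open Finset

variable {V : Type} {G : SimpleGraph V}

theorem degreeMod_single [Fintype V] {a b : V} (hab : a ≠ b) (y : V) :
    degreeMod (Pi.single s(a, b) 1) y = (if a = y then 1 else 0) + (if b = y then 1 else 0) := by
  unfold degreeMod
  rw [sum_eq_single s(a, b)]
  · rw [Pi.single_eq_same]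
    simp only [Sym2.mem_iff]
    by_cases h1 : y = a
    · simp [h1]
      exact fun h => absurd h.symm hab
    · have h1' : ¬ a = y := fun h => h1 h.symm
      simp [h1, h1', eq_comm]
  · intro e _ he
    rw [Pi.single_eq_of_ne he, ite_self]
  · simp

theorem degreeMod_sum [Fintype V] {ι : Type} (C : Finset ι) (x : ι → Sym2 V → ZMod 2) (y : V) :
    degreeMod (∑ i ∈ C, x i) y = ∑ i ∈ C, degreeMod (x i) y := by
  induction C using Finset.induction_on with
  | empty => simp [degreeMod]
  | insert i C hi ih => rw [sum_insert hi, sum_insert hi, degreeMod_add, ih]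

theorem even_degree_of_degreeMod_eq_zero [Fintype V] {x : Sym2 V → ZMod 2} {y : V}
    (h : degreeMod x y = 0) :
    Even ((univ.filter fun e => x e ≠ 0).filter fun e => y ∈ e).card := by
  rw [← ZMod.natCast_eq_zero_iff_even]
  refine Eq.trans ?_ h
  rw [degreeMod, filter_filter, card_eq_sum_ones, Nat.cast_sum, sum_filter]
  refine sum_congr rfl fun e _ => ?_
  by_cases hx : x e = 0
  · simp [hx]
  · simp [zmod_two_eq_one_of_ne_zero hx]

theorem zmod_two_add_self (x : Sym2 V → ZMod 2) : x + x = 0 := by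
  funext e
  exact CharTwo.add_self_eq_zero _

namespace RootedForest

variable (T : RootedForest G)

theorem head?_path_of_eq {u : V} (h : T.path u = T.path (T.parent u) ++ [u]) :
    (T.path u).head? = (T.path (T.parent u)).head? := by
  rw [h, List.head?_append_of_ne_nil _ (T.path_parent_ne_nil u)]

/-- Telescoping mod 2: the root path of every inner vertex of the walk occurs twice. -/
theorem sum_fundamental_walk {u v : V} (w : G.Walk u v) :
    (w.edges.map T.fundamental).sum
      = (w.edges.map fun e => (Pi.single e 1 : Sym2 V → ZMod 2)).sum
        + (T.pathVec u + T.pathVec v) := by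
  induction w with
  | nil => simp [zmod_two_add_self]
  | @cons a b c hab w ih =>
    rw [SimpleGraph.Walk.edges_cons, List.map_cons, List.map_cons, List.sum_cons, List.sum_cons, ih,
      fundamental_mk]
    have := zmod_two_add_self (T.pathVec b)
    linear_combination (exp := 1) this

/-- On a closed walk the root paths cancel completely, so the fundamental vectors of the edges of a
cycle sum to the cycle itself, which has the value 1 at `e`. -/
theorem exists_fundamental_of_mem_cycle {u : V} {w : G.Walk u u} (hw : w.IsCycle) {e : Sym2 V}
    (he : e ∈ w.edges) : ∃ f ∈ w.edges, T.fundamental f e ≠ 0 := by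
  by_contra! hcon
  have h := congrFun (T.sum_fundamental_walk w) e
  have key : ∀ (l : List (Sym2 V)) (g : Sym2 V → Sym2 V → ZMod 2),
      (l.map g).sum e = (l.map fun f => g f e).sum := by
    intro l g
    induction l with
    | nil => rfl
    | cons f l ih => simp only [List.map_cons, List.sum_cons, Pi.add_apply, ih]
  rw [zmod_two_add_self, add_zero, key, key,
    ← List.sum_toFinset _ hw.isCircuit.isTrail.edges_nodup,
    ← List.sum_toFinset _ hw.isCircuit.isTrail.edges_nodup,
    sum_eq_zero (fun f hf => hcon f (List.mem_toFinset.1 hf)),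
    sum_eq_single e] at h
  · simp at h
  · intro f _ hf
    exact Pi.single_eq_of_ne hf.symm _
  · intro h
    exact absurd (List.mem_toFinset.2 he) h

variable [Fintype V]

theorem degreeMod_pathVec (u y : V) : degreeMod (T.pathVec u) y
    = (if u = y then 1 else 0) + (if (T.path u).head? = some y then 1 else 0) := by
  induction u using T.path_induction with
  | root u hu =>
    rw [T.pathVec_of_root hu, hu]
    simp only [degreeMod, List.head?_cons, Option.some.injEq, Pi.zero_apply, ite_self, sum_const_zero]
    split_ifs <;> decide
  | step u ha hu ih =>
    rw [T.pathVec_of_ne hu, degreeMod_add, ih, degreeMod_single ha.ne, T.head?_path_of_eq hu]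
    have := CharTwo.add_self_eq_zero (if T.parent u = y then 1 else 0 : ZMod 2)
    linear_combination (exp := 1) this

/-- A root path has odd degree only at its two ends. If both endpoints of `f` have the same root,
the roots cancel, and `f` itself cancels the other ends. -/
theorem degreeMod_fundamental {f : Sym2 V} (hf : f ∈ G.edgeSet)
    (hr : ∀ a ∈ f, ∀ b ∈ f, (T.path a).head? = (T.path b).head?) (y : V) :
    degreeMod (T.fundamental f) y = 0 := by
  induction f using Sym2.ind with
  | _ a b =>
    have hab : G.Adj a b := hf
    rw [fundamental_mk, degreeMod_add, degreeMod_add, degreeMod_pathVec, degreeMod_pathVec,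
      degreeMod_single hab.ne, hr a (by simp) b (by simp)]
    split_ifs <;> decide

end RootedForest

/-- The vertices that can be reached from `v` by at most `k` steps inside `R`. -/
noncomputable def ballIn (G : SimpleGraph V) (R : Finset V) (v : V) : ℕ → Finset V
  | 0 => {v}
  | k + 1 => R.filter fun y => y ∈ ballIn G R v k ∨ ∃ x ∈ ballIn G R v k, G.Adj x y

theorem ballIn_subset {R : Finset V} {v : V} (hv : v ∈ R) (k : ℕ) : ballIn G R v k ⊆ R := by
  cases k with
  | zero => simpa [ballIn] using hv
  | succ k => exact filter_subset _ _

theorem ballIn_mono {R : Finset V} {v : V} (hv : v ∈ R) : Monotone (ballIn G R v) :=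
  monotone_nat_of_le_succ fun k _ hx => mem_filter.2 ⟨ballIn_subset hv k hx, Or.inl hx⟩

theorem mem_ballIn_of_walk {R : Finset V} {v : V} {x y : V} (w : G.Walk x y)
    (hw : ∀ z ∈ w.support, z ∈ R) {k : ℕ} (hx : x ∈ ballIn G R v k) :
    y ∈ ballIn G R v (k + w.length) := by
  induction w generalizing k with
  | nil => exact hx
  | @cons a b c hab w ih =>
    rw [SimpleGraph.Walk.length_cons, ← add_assoc, add_right_comm]
    refine ih (fun z hz => hw z (by simp [hz])) (mem_filter.2 ⟨hw b (by simp), Or.inr ⟨a, hx, hab⟩⟩)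

/-- When the ball grows, old vertices keep their paths and each new vertex is hung on a neighbour in
the old ball, so the tree never leaves the ball. -/
theorem exists_ball_forest {R : Finset V} {v : V} (hv : v ∈ R) (k : ℕ) :
    ∃ (path : V → List V) (parent : V → V), ∀ u ∈ ballIn G R v k,
      (path u = [u] ∨ parent u ∈ ballIn G R v k ∧ G.Adj (parent u) u ∧
        path u = path (parent u) ++ [u]) ∧
      (path u).length ≤ k + 1 ∧ (path u).head? = some v := by
  induction k with
  | zero =>
    refine ⟨fun u => [u], id, fun u hu => ?_⟩
    have : u = v := by simpa [ballIn] using hu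
    simp [this]
  | succ k ih =>
    obtain ⟨path, parent, h⟩ := ih
    have hex : ∀ u, ∃ x, u ∈ ballIn G R v (k + 1) → u ∉ ballIn G R v k →
        x ∈ ballIn G R v k ∧ G.Adj x u := by
      intro u
      by_cases hu : u ∈ ballIn G R v (k + 1) ∧ u ∉ ballIn G R v k
      · obtain ⟨x, hx, hxu⟩ := ((mem_filter.1 hu.1).2).resolve_left hu.2
        exact ⟨x, fun _ _ => ⟨hx, hxu⟩⟩
      · exact ⟨v, fun h1 h2 => absurd ⟨h1, h2⟩ hu⟩
    choose nb hnb using hex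
    refine ⟨fun u => if u ∈ ballIn G R v k then path u else path (nb u) ++ [u],
      fun u => if u ∈ ballIn G R v k then parent u else nb u, fun u hu => ?_⟩
    have hmono := ballIn_mono (G := G) hv (Nat.le_succ k)
    by_cases huk : u ∈ ballIn G R v k
    · obtain ⟨h1, h2, h3⟩ := h u huk
      simp only [huk, if_true]
      refine ⟨h1.imp_right fun ⟨h4, h5, h6⟩ => ⟨hmono h4, h5, by simp [h4, ← h6]⟩, by omega, h3⟩
    · obtain ⟨hx, hxu⟩ := hnb u hu huk
      obtain ⟨h1, h2, h3⟩ := h _ hx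
      simp only [huk, if_false]
      refine ⟨Or.inr ⟨hmono hx, hxu, by simp [hx]⟩, by simpa using h2, ?_⟩
      rw [List.head?_append, h3]
      rfl

/-- Ball growing: the vertices can be partitioned into clusters of small radius such that at
least half of the given sets of small diameter lie inside a cluster. -/
theorem exists_clustering {ε : Type} [Fintype V] (d : ℕ) (U : Finset ε) (S : ε → Finset V)
    (hne : ∀ e ∈ U, (S e).Nonempty)
    (hS : ∀ e ∈ U, ∀ x ∈ S e, ∀ y ∈ S e, ∃ w : G.Walk x y, w.length ≤ d ∧ ∀ z ∈ w.support, z ∈ S e) :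
    ∃ T : RootedForest G, (∀ u, (T.path u).length ≤ d * (Nat.log 2 U.card + 1) + 1) ∧
      U.card ≤ 2 * (U.filter fun e => ∃ r, ∀ x ∈ S e, (T.path x).head? = some r).card := by
  have main : ∀ R : Finset V, ∃ (path : V → List V) (parent : V → V),
      (∀ u ∈ R, (path u = [u] ∨ parent u ∈ R ∧ G.Adj (parent u) u ∧
        path u = path (parent u) ++ [u]) ∧
        (path u).length ≤ d * (Nat.log 2 U.card + 1) + 1) ∧
      (U.filter fun e => S e ⊆ R).card ≤ 2 * (U.filter fun e => S e ⊆ R ∧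
        ∃ r, ∀ x ∈ S e, (path x).head? = some r).card := by
    intro R
    induction R using Finset.strongInduction with
    | H R ih =>
      set UR := U.filter fun e => S e ⊆ R with hUR
      rcases UR.eq_empty_or_nonempty with h0 | ⟨e₀, he₀⟩
      · refine ⟨fun u => [u], id, fun u _ => by simp, by rw [h0]; simp⟩
      obtain ⟨he₀U, he₀R⟩ := mem_filter.1 he₀
      obtain ⟨v, hvS⟩ := hne e₀ he₀U
      have hvR := he₀R hvS
      set a : ℕ → Finset ε := fun k => UR.filter fun e => ¬ Disjoint (S e) (ballIn G R v (k * d))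
        with ha
      -- The count `(a k).card` starts at 1 or more and never exceeds `U.card`, so it cannot more
      -- than double at every radius.
      obtain ⟨k, hk, hak⟩ : ∃ k ≤ Nat.log 2 U.card, (a (k + 1)).card ≤ 2 * (a k).card := by
        by_contra! hcon
        have hgrow : ∀ k ≤ Nat.log 2 U.card + 1, 2 ^ k ≤ (a k).card := by
          intro k
          induction k with
          | zero =>
            intro _
            rw [pow_zero]
            refine card_pos.2 ⟨e₀, mem_filter.2 ⟨he₀, not_disjoint_iff.2 ⟨v, hvS, ?_⟩⟩⟩
            simp [ballIn]
          | succ k ihk =>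
            intro hk
            have := ihk (by omega)
            have := hcon k (by omega)
            rw [pow_succ]
            omega
        have h1 := hgrow _ le_rfl
        have h2 : (a (Nat.log 2 U.card + 1)).card ≤ U.card :=
          card_le_card ((filter_subset _ _).trans (filter_subset _ _))
        have h3 := Nat.lt_pow_succ_log_self (b := 2) (by norm_num) U.card
        simp only [Nat.succ_eq_add_one] at h3
        omega
      set B := ballIn G R v ((k + 1) * d) with hB
      have hBR : B ⊆ R := ballIn_subset hvR _
      have hvB : v ∈ B := ballIn_mono hvR (Nat.zero_le _) (by simp [ballIn])
      obtain ⟨path₁, parent₁, h₁⟩ := exists_ball_forest (G := G) hvR ((k + 1) * d)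
      obtain ⟨path₂, parent₂, h₂, hc₂⟩ := ih (R \ B) (sdiff_ssubset hBR ⟨v, hvB⟩)
      refine ⟨fun u => if u ∈ B then path₁ u else path₂ u,
        fun u => if u ∈ B then parent₁ u else parent₂ u, ?_, ?_⟩
      · intro u hu
        by_cases huB : u ∈ B
        · obtain ⟨g1, g2, g3⟩ := h₁ u huB
          simp only [huB, if_true]
          have hle : (k + 1) * d ≤ d * (Nat.log 2 U.card + 1) := by
            rw [mul_comm]
            exact Nat.mul_le_mul_left _ (by omega)
          exact ⟨g1.imp_right fun ⟨h4, h5, h6⟩ => ⟨hBR h4, h5, by rw [if_pos h4, ← h6]⟩,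
            g2.trans (Nat.add_le_add_right hle 1)⟩
        · obtain ⟨g1, g2⟩ := h₂ u (mem_sdiff.2 ⟨hu, huB⟩)
          simp only [huB, if_false]
          exact ⟨g1.imp_right fun ⟨h4, h5, h6⟩ => ⟨(mem_sdiff.1 h4).1, h5, by
            rw [if_neg (mem_sdiff.1 h4).2, ← h6]⟩, g2⟩
      -- Sets that meet `B` are in `a (k + 1)`, at most twice as many as those in `a k`, and the
      -- latter lie wholly in `B`. All other sets survive in `R \ B` for the induction.
      · have hsplit : UR ⊆ a (k + 1) ∪ U.filter fun e => S e ⊆ R \ B := by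
          intro e he
          by_cases hd : Disjoint (S e) B
          · refine mem_union_right _ (mem_filter.2 ⟨(mem_filter.1 he).1, ?_⟩)
            exact subset_sdiff.2 ⟨(mem_filter.1 he).2, hd⟩
          · exact mem_union_left _ (mem_filter.2 ⟨he, hd⟩)
        have hin : ∀ e ∈ a k, S e ⊆ B := by
          intro e he y hy
          obtain ⟨heR, hd⟩ := mem_filter.1 he
          obtain ⟨heU, heS⟩ := mem_filter.1 heR
          obtain ⟨x, hxS, hxB⟩ := not_disjoint_iff.1 hd
          obtain ⟨w, hwl, hws⟩ := hS e heU x hxS y hy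
          have := mem_ballIn_of_walk w (fun z hz => heS (hws z hz)) hxB
          refine ballIn_mono hvR ?_ this
          rw [add_mul, one_mul]
          omega
        set good₂ := U.filter fun e => S e ⊆ R \ B ∧ ∃ r, ∀ x ∈ S e, (path₂ x).head? = some r
          with hgood₂
        have hdisj : Disjoint (a k) good₂ := by
          rw [disjoint_left]
          intro e he he'
          obtain ⟨heU, heS, -⟩ := mem_filter.1 he'
          obtain ⟨x, hx⟩ := hne e heU
          exact (mem_sdiff.1 (heS hx)).2 (hin e he hx)
        have hsub : a k ∪ good₂ ⊆ U.filter fun e => S e ⊆ R ∧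
            ∃ r, ∀ x ∈ S e, (if x ∈ B then path₁ x else path₂ x).head? = some r := by
          intro e he
          rcases mem_union.1 he with he | he
          · obtain ⟨heU, heS⟩ := mem_filter.1 (mem_filter.1 he).1
            refine mem_filter.2 ⟨heU, heS, v, fun x hx => ?_⟩
            rw [if_pos (hin e he hx)]
            exact (h₁ x (hin e he hx)).2.2
          · obtain ⟨heU, heS, r, hr⟩ := mem_filter.1 he
            refine mem_filter.2 ⟨heU, heS.trans sdiff_subset, r, fun x hx => ?_⟩
            rw [if_neg (mem_sdiff.1 (heS hx)).2]
            exact hr x hx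
        have g1 := (card_le_card hsplit).trans (card_union_le _ _)
        have g2 := card_le_card hsub
        rw [card_union_of_disjoint hdisj] at g2
        refine le_trans ?_ (Nat.mul_le_mul_left 2 g2)
        omega
  obtain ⟨path, parent, h, hc⟩ := main univ
  refine ⟨⟨path, parent, fun u => (h u (mem_univ _)).1.imp_right fun h => h.2⟩,
    fun u => (h u (mem_univ _)).2, ?_⟩
  simpa using hc

end

/-! ### A cover of the edges by small even sets of low congestion -/

section
open scoped Classical
open Finset

variable {V : Type} {G : SimpleGraph V}

theorem exists_walk_of_mem_support {u x y : V} (w : G.Walk u u) (hx : x ∈ w.support)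
    (hy : y ∈ w.support) :
    ∃ p : G.Walk x y, p.length ≤ 2 * w.length ∧ ∀ z ∈ p.support, z ∈ w.support := by
  refine ⟨(w.takeUntil x hx).reverse.append (w.takeUntil y hy), ?_, fun z hz => ?_⟩
  · have h1 := w.length_takeUntil_le_length hx
    have h2 := w.length_takeUntil_le_length hy
    rw [SimpleGraph.Walk.length_append, SimpleGraph.Walk.length_reverse]
    omega
  · rw [SimpleGraph.Walk.mem_support_append_iff, SimpleGraph.Walk.support_reverse,
      List.mem_reverse] at hz
    rcases hz with h | h
    · exact w.support_takeUntil_subset_support hx h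
    · exact w.support_takeUntil_subset_support hy h

/-- A family of sets of edges of `G`, all with even degrees and with at most `D` elements, such that
no edge is in more than `c` of them. -/
def IsEvenFamily (G : SimpleGraph V) (L : Multiset (Finset (Sym2 V))) (D c : ℕ) : Prop :=
  (∀ W ∈ L, (∀ e ∈ W, e ∈ G.edgeSet) ∧ (∀ y, Even (W.filter fun e => y ∈ e).card) ∧ W.card ≤ D) ∧
    ∀ e, L.countP (fun W => e ∈ W) ≤ c

theorem IsEvenFamily.add {L L' : Multiset (Finset (Sym2 V))} {D c c' : ℕ}
    (h : IsEvenFamily G L D c) (h' : IsEvenFamily G L' D c') :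
    IsEvenFamily G (L + L') D (c + c') := by
  refine ⟨fun W hW => ?_, fun e => ?_⟩
  · rcases Multiset.mem_add.1 hW with hW | hW
    · exact h.1 W hW
    · exact h'.1 W hW
  · rw [Multiset.countP_add]
    exact add_le_add (h.2 e) (h'.2 e)

variable [Fintype V]

/-- One factor 2 is lost in the clustering, another in making the sum of the fundamental vectors of
`F` odd. The spans of the pieces add up to that sum, so every edge where it is odd lies in the span
of some piece. -/
theorem exists_evenFamily_quarter {d k : ℕ}
    (hG : ∀ e ∈ G.edgeSet, ∃ (u : V) (w : G.Walk u u), w.IsCycle ∧ w.length ≤ d ∧ e ∈ w.edges)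
    (hk : G.edgeFinset.card < 2 ^ k) (U : Finset (Sym2 V)) (hU : U ⊆ G.edgeFinset) :
    ∃ L, IsEvenFamily G L ((2 * k + 3) * (1 + 2 * (2 * d * (k + 1) + 1))) (k * 65) ∧
      U.card ≤ 4 * (U.filter fun e => ∃ W ∈ L, e ∈ W).card := by
  have hG' : ∀ e, ∃ (u : V) (w : G.Walk u u), e ∈ U → w.IsCycle ∧ w.length ≤ d ∧ e ∈ w.edges := by
    intro e
    by_cases he : e ∈ U
    · obtain ⟨u, w, h⟩ := hG e (SimpleGraph.mem_edgeFinset.1 (hU he))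
      exact ⟨u, w, fun _ => h⟩
    · exact ⟨(Quot.out e).1, .nil, fun h => absurd h he⟩
  choose base w hw using hG'
  obtain ⟨T, hTl, hTU⟩ := exists_clustering (G := G) (2 * d) U (fun e => (w e).support.toFinset)
    (fun e _ => ⟨base e, by simp⟩) (by
      intro e he x hx y hy
      obtain ⟨p, hp, hps⟩ := exists_walk_of_mem_support (w e) (List.mem_toFinset.1 hx)
        (List.mem_toFinset.1 hy)
      have := (hw e he).2.1
      exact ⟨p, by omega, fun z hz => List.mem_toFinset.2 (hps z hz)⟩)
  have hlogU : Nat.log 2 U.card ≤ k := by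
    refine (Nat.log_mono_right ((card_le_card hU).trans hk.le)).trans ?_
    rw [Nat.log_pow (by norm_num)]
  have hlogE : Nat.log 2 G.edgeFinset.card ≤ k := by
    refine (Nat.log_mono_right hk.le).trans ?_
    rw [Nat.log_pow (by norm_num)]
  have hTl' : ∀ u, (T.path u).length ≤ 2 * d * (k + 1) + 1 := fun u =>
    (hTl u).trans (Nat.add_le_add_right (Nat.mul_le_mul_left _ (by omega)) 1)
  set U' := U.filter fun e => ∃ r, ∀ x ∈ (w e).support.toFinset, (T.path x).head? = some r with hU'
  set F₀ := G.edgeFinset.filter fun f => ∀ a ∈ f, ∀ b ∈ f, (T.path a).head? = (T.path b).head?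
    with hF₀
  obtain ⟨F, hFF, hFU⟩ := exists_subset_half_odd T.fundamental F₀ U' 0 (by
    intro e he
    obtain ⟨heU, r, hr⟩ := mem_filter.1 he
    obtain ⟨f, hf, hfe⟩ := T.exists_fundamental_of_mem_cycle (hw e heU).1 (hw e heU).2.2
    refine ⟨f, mem_filter.2 ⟨SimpleGraph.mem_edgeFinset.2 ((w e).edges_subset_edgeSet hf), ?_⟩, hfe⟩
    intro a ha b hb
    rw [hr a (List.mem_toFinset.2 ((w e).mem_support_of_mem_edges hf ha)),
      hr b (List.mem_toFinset.2 ((w e).mem_support_of_mem_edges hf hb))])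
  have hFE : F ⊆ G.edgeFinset := hFF.trans (filter_subset _ _)
  obtain ⟨𝓕, h𝓕, hdisj, hUn, hcong⟩ := T.exists_decomposition G.edgeFinset.card k F
    (card_le_card hFE) ((card_le_card hFE).trans_lt hk)
  refine ⟨𝓕.val.map fun C => univ.filter fun e => T.span C e ≠ 0, ⟨?_, ?_⟩, ?_⟩
  · intro W hW
    obtain ⟨C, hC, rfl⟩ := Multiset.mem_map.1 hW
    obtain ⟨hCF, -, hCc⟩ := h𝓕 C hC
    refine ⟨fun e he => ?_, fun y => ?_, ?_⟩
    · exact T.span_ne_zero_mem_edgeSet (fun f hf => SimpleGraph.mem_edgeFinset.1 (hFE (hCF hf)))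
        (mem_filter.1 he).2
    · apply even_degree_of_degreeMod_eq_zero
      rw [RootedForest.span, degreeMod_sum]
      refine sum_eq_zero fun f hf => ?_
      obtain ⟨h1, h2⟩ := mem_filter.1 (hFF (hCF hf))
      exact T.degreeMod_fundamental (SimpleGraph.mem_edgeFinset.1 h1) h2 y
    · refine (T.card_support_span_le hTl' C).trans (Nat.mul_le_mul_right _ (hCc.trans ?_))
      omega
  · intro e
    rw [Multiset.countP_map]
    refine le_trans (le_of_eq ?_) (hcong e)
    rw [card_def, filter_val]
    congr 1
    apply Multiset.filter_congr
    intro C _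
    simp
  · have hsub : (U'.filter fun e => (0 : Sym2 V → ZMod 2) e + ∑ f ∈ F, T.fundamental f e ≠ 0) ⊆
        U.filter fun e => ∃ W ∈ 𝓕.val.map fun C => univ.filter fun e => T.span C e ≠ 0, e ∈ W := by
      intro e he
      obtain ⟨heU, hs⟩ := mem_filter.1 he
      refine mem_filter.2 ⟨(mem_filter.1 heU).1, ?_⟩
      have hs' : (∑ C ∈ 𝓕, T.span C) e ≠ 0 := by
        rw [← T.span_biUnion hdisj, hUn, RootedForest.span, Finset.sum_apply]
        simpa using hs
      rw [Finset.sum_apply] at hs'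
      obtain ⟨C, hC, hCe⟩ := exists_ne_zero_of_sum_ne_zero hs'
      exact ⟨_, Multiset.mem_map.2 ⟨C, hC, rfl⟩, mem_filter.2 ⟨mem_univ _, hCe⟩⟩
    have := card_le_card hsub
    omega

/-- Each step leaves at most three quarters of the edges uncovered, and the congestions add up. -/
theorem exists_evenFamily_cover_of_step {D c : ℕ}
    (step : ∀ U ⊆ G.edgeFinset, ∃ L, IsEvenFamily G L D c ∧
      U.card ≤ 4 * (U.filter fun e => ∃ W ∈ L, e ∈ W).card) :
    ∀ (k : ℕ), ∀ U ⊆ G.edgeFinset, U.card * 3 ^ k < 4 ^ k →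
      ∃ L, IsEvenFamily G L D (k * c) ∧ ∀ e ∈ U, ∃ W ∈ L, e ∈ W := by
  intro k
  induction k with
  | zero =>
    intro U _ hU
    have : U = ∅ := by
      rw [← card_eq_zero]
      simpa using hU
    subst this
    exact ⟨0, ⟨by simp, by simp⟩, by simp⟩
  | succ k ih =>
    intro U hUE hU
    obtain ⟨L, hL, hLU⟩ := step U hUE
    set U' := U.filter fun e => ¬ ∃ W ∈ L, e ∈ W with hU'
    have hc : (U.filter fun e => ∃ W ∈ L, e ∈ W).card + U'.card = U.card := by
      rw [hU', ← card_filter_add_card_filter_not (s := U) (fun e => ∃ W ∈ L, e ∈ W)]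
    obtain ⟨L', hL', hLU'⟩ := ih U' ((filter_subset _ _).trans hUE) (by
      have h1 : 4 * U'.card ≤ 3 * U.card := by omega
      have h2 := Nat.mul_le_mul_right (3 ^ k) h1
      rw [pow_succ, pow_succ] at hU
      nlinarith)
    refine ⟨L + L', ?_, fun e he => ?_⟩
    · rw [add_mul, one_mul, add_comm (k * c)]
      exact hL.add hL'
    · by_cases h : ∃ W ∈ L, e ∈ W
      · obtain ⟨W, hW, heW⟩ := h
        exact ⟨W, Multiset.mem_add.2 (Or.inl hW), heW⟩
      · obtain ⟨W, hW, heW⟩ := hLU' e (mem_filter.2 ⟨he, h⟩)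
        exact ⟨W, Multiset.mem_add.2 (Or.inr hW), heW⟩

theorem card_edgeFinset_lt [Nonempty V] :
    G.edgeFinset.card < 2 ^ (2 * Nat.clog 2 (Fintype.card V)) := by
  have h1 := G.card_edgeFinset_le_card_choose_two
  have h2 : (Fintype.card V).choose 2 < Fintype.card V ^ 2 := by
    have := Fintype.card_pos (α := V)
    rw [Nat.choose_two_right, sq]
    refine (Nat.div_le_self _ _).trans_lt ?_
    exact Nat.mul_lt_mul_of_pos_left (by omega) this
  have h3 : Fintype.card V ^ 2 ≤ 2 ^ (2 * Nat.clog 2 (Fintype.card V)) := by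
    rw [mul_comm, pow_mul]
    exact Nat.pow_le_pow_left (Nat.le_pow_clog (by norm_num) _) 2
  omega

/-- If every edge of `G` is on a cycle of length at most `d`, then the edges of `G` can be covered by
even sets of `O(d log² n)` edges such that every edge is in `O(log² n)` of them. -/
theorem exists_evenFamily_cover [Nonempty V] {d : ℕ}
    (hG : ∀ e ∈ G.edgeSet, ∃ (u : V) (w : G.Walk u u), w.IsCycle ∧ w.length ≤ d ∧ e ∈ w.edges)
    {l : ℕ} (hl : l = Nat.clog 2 (Fintype.card V)) :
    ∃ L, IsEvenFamily G L ((4 * l + 3) * (1 + 2 * (2 * d * (2 * l + 1) + 1))) (780 * l ^ 2) ∧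
      ∀ e ∈ G.edgeSet, ∃ W ∈ L, e ∈ W := by
  have hE : G.edgeFinset.card < 2 ^ (2 * l) := hl ▸ card_edgeFinset_lt
  -- The number of edges is below `2 ^ (2 * l)`, and `2 * 3 ^ 3 ≤ 4 ^ 3`, so three steps per factor
  -- 2 suffice.
  obtain ⟨L, hL, hLE⟩ := exists_evenFamily_cover_of_step (exists_evenFamily_quarter hG hE)
    (3 * (2 * l)) _ subset_rfl (by
      have h1 : G.edgeFinset.card * 3 ^ (3 * (2 * l)) < 2 ^ (2 * l) * 3 ^ (3 * (2 * l)) :=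
        Nat.mul_lt_mul_of_pos_right hE (by positivity)
      refine h1.trans_le ?_
      rw [pow_mul 3 3, pow_mul 4 3, ← mul_pow]
      exact Nat.pow_le_pow_left (by norm_num) _)
  refine ⟨L, ?_, fun e he => hLE e (SimpleGraph.mem_edgeFinset.2 he)⟩
  convert hL using 1 <;> ring

end

/-! ### Closed trails and the schedule for the keys -/

section
open scoped Classical
open Finset

theorem exists_involution_of_even {α : Type} [Nonempty α] (s : Finset α) (hs : Even s.card) :
    ∃ μ : α → α, ∀ x ∈ s, μ x ∈ s ∧ μ x ≠ x ∧ μ (μ x) = x := by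
  obtain ⟨k, hk⟩ := hs
  let φ : s ≃ Fin k ⊕ Fin k := (s.equivFinOfCardEq hk).trans finSumFinEquiv.symm
  let ν : s → s := fun x => φ.symm (φ x).swap
  refine ⟨fun x => if h : x ∈ s then ν ⟨x, h⟩ else x, fun x hx => ?_⟩
  have h1 : (ν ⟨x, hx⟩ : α) ∈ s := (ν ⟨x, hx⟩).2
  simp only [hx, dif_pos, h1]
  refine ⟨trivial, fun h => ?_, ?_⟩
  · have : φ (ν ⟨x, hx⟩) = φ ⟨x, hx⟩ := by
      congr 1
      exact Subtype.ext h
    simp only [ν, Equiv.apply_symm_apply] at this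
    cases hφ : φ ⟨x, hx⟩ <;> simp [hφ] at this
  · simp [ν]

variable {V : Type} {G : SimpleGraph V}

theorem iterate_edge_mem {W : Finset (Sym2 V)} {σ : G.Dart → G.Dart}
    (h : ∀ f, f.edge ∈ W → (σ f).edge ∈ W) (j : ℕ) {f : G.Dart} (hf : f.edge ∈ W) :
    (σ^[j] f).edge ∈ W := by
  induction j generalizing f with
  | zero => exact hf
  | succ j ih => exact ih (h f hf)

variable [Fintype V]

/-- An even set of edges can be decomposed into closed trails: `σ` maps every dart to the next dart
on its trail, and a trail does not traverse an edge in both orientations. -/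
theorem exists_trail_decomposition {W : Finset (Sym2 V)}
    (hWE : ∀ y, Even (W.filter fun e => y ∈ e).card) (hWG : ∀ e ∈ W, e ∈ G.edgeSet) :
    ∃ σ : G.Dart → G.Dart, Function.Injective σ ∧ ∀ f, f.edge ∈ W →
      (σ f).edge ∈ W ∧ (σ f).fst = f.snd ∧ ∀ k, σ^[k] f ≠ f.symm := by
  by_cases hne : Nonempty G.Dart
  swap
  · exact ⟨id, Function.injective_id, fun f => absurd ⟨f⟩ hne⟩
  -- The darts of `W` that leave `y` are paired up. A trail that arrives along `f` leaves along the
  -- partner of `f.symm`.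
  have hpair : ∀ y : V, ∃ μ : G.Dart → G.Dart, ∀ f, f.fst = y → f.edge ∈ W →
      (μ f).fst = y ∧ (μ f).edge ∈ W ∧ μ f ≠ f ∧ μ (μ f) = f := by
    intro y
    obtain ⟨μ, hμ⟩ := exists_involution_of_even
      (univ.filter fun f : G.Dart => f.fst = y ∧ f.edge ∈ W) (by
        convert hWE y using 1
        refine card_bij (fun f _ => f.edge) ?_ ?_ ?_
        · intro f hf
          obtain ⟨h1, h2⟩ := (mem_filter.1 hf).2
          refine mem_filter.2 ⟨h2, ?_⟩
          rw [← h1]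
          exact Sym2.mem_mk_left _ _
        · intro f hf g hg hfg
          rcases (SimpleGraph.dart_edge_eq_iff f g).1 hfg with h | h
          · exact h
          · exfalso
            have h1 := (mem_filter.1 hf).2.1
            have h2 := (mem_filter.1 hg).2.1
            rw [h] at h1
            exact g.snd_ne_fst (h1.trans h2.symm)
        · intro e he
          obtain ⟨heW, hye⟩ := mem_filter.1 he
          obtain ⟨z, rfl⟩ := Sym2.mem_iff_exists.1 hye
          exact ⟨⟨(y, z), hWG _ heW⟩, mem_filter.2 ⟨mem_univ _, rfl, heW⟩, rfl⟩)
    refine ⟨μ, fun f h1 h2 => ?_⟩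
    obtain ⟨h3, h4, h5⟩ := hμ f (mem_filter.2 ⟨mem_univ _, h1, h2⟩)
    exact ⟨(mem_filter.1 h3).2.1, (mem_filter.1 h3).2.2, h4, h5⟩
  choose μ hμ using hpair
  set ν : G.Dart → G.Dart := fun f => μ f.fst f with hν
  have hν1 : ∀ f, f.edge ∈ W → (ν f).fst = f.fst ∧ (ν f).edge ∈ W ∧ ν f ≠ f ∧ ν (ν f) = f := by
    intro f hf
    obtain ⟨h1, h2, h3, h4⟩ := hμ f.fst f rfl hf
    exact ⟨h1, h2, h3, by simp only [hν, h1, h4]⟩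
  set σ : G.Dart → G.Dart := fun f => if f.edge ∈ W then ν f.symm else f with hσ
  have hσ1 : ∀ f, f.edge ∈ W → σ f = ν f.symm := fun f hf => if_pos hf
  have hsymm : ∀ f : G.Dart, f.edge ∈ W → f.symm.edge ∈ W := fun f hf => by
    rwa [SimpleGraph.Dart.edge_symm]
  have hσW : ∀ f, f.edge ∈ W → (σ f).edge ∈ W := fun f hf => by
    rw [hσ1 f hf]
    exact (hν1 _ (hsymm f hf)).2.1
  have hνσ : ∀ f, f.edge ∈ W → ν (σ f) = f.symm := fun f hf => by
    rw [hσ1 f hf]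
    exact (hν1 _ (hsymm f hf)).2.2.2
  refine ⟨σ, ?_, fun f hf => ⟨hσW f hf, ?_, ?_⟩⟩
  · intro f g hfg
    by_cases hf : f.edge ∈ W
    · by_cases hg : g.edge ∈ W
      · have := hνσ f hf
        rw [hfg, hνσ g hg] at this
        exact (SimpleGraph.Dart.symm_involutive.injective this).symm
      · have h1 := hσW f hf
        rw [hfg, show σ g = g from if_neg hg] at h1
        exact absurd h1 hg
    · by_cases hg : g.edge ∈ W
      · have h1 := hσW g hg
        rw [← hfg, show σ f = f from if_neg hf] at h1
        exact absurd h1 hf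
      · rwa [show σ f = f from if_neg hf, show σ g = g from if_neg hg] at hfg
  · rw [hσ1 f hf]
    exact (hν1 _ (hsymm f hf)).1
  -- If `σ^[k + 2] f = f.symm`, undoing the last step gives `σ^[k] (σ f) = (σ f).symm`, which is two
  -- steps shorter. In the base cases a dart would be its own reverse or its own partner.
  · intro k
    induction k using Nat.strong_induction_on generalizing f with
    | _ k ih =>
      match k, ih with
      | 0, _ => exact f.symm_ne.symm
      | 1, _ =>
        rw [Function.iterate_one, hσ1 f hf]
        exact (hν1 _ (hsymm f hf)).2.2.1
      | k + 2, ih =>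
        intro h
        refine ih k (by omega) (σ f) (hσW f hf) ?_
        have h1 : σ (σ^[k] (σ f)) = f.symm := by
          rw [← Function.iterate_succ_apply' σ k (σ f), ← Function.iterate_succ_apply σ (k + 1) f]
          exact h
        have h2 := hνσ _ (iterate_edge_mem hσW k (hσW f hf))
        rw [h1, ← hσ1 f hf] at h2
        rw [← SimpleGraph.Dart.symm_symm (σ^[k] (σ f)), ← h2]

theorem exists_period_le {W : Finset (Sym2 V)} {σ : G.Dart → G.Dart} (hinj : Function.Injective σ)
    (h : ∀ f, f.edge ∈ W → (σ f).edge ∈ W) {f : G.Dart} (hf : f.edge ∈ W) :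
    ∃ p, 0 < p ∧ p ≤ 2 * W.card ∧ σ^[p] f = f ∧ ∀ j, 0 < j → j < p → σ^[j] f ≠ f := by
  have hper : f ∈ Function.periodicPts σ := by
    obtain ⟨i, j, hij, heq⟩ := Finite.exists_ne_map_eq_of_infinite fun n => σ^[n] f
    rcases lt_or_gt_of_ne hij with hlt | hlt
    · exact ⟨j - i, by omega, Function.iterate_cancel hinj heq.symm⟩
    · exact ⟨i - j, by omega, Function.iterate_cancel hinj heq⟩
  refine ⟨Function.minimalPeriod σ f, Function.minimalPeriod_pos_of_mem_periodicPts hper, ?_,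
    Function.isPeriodicPt_minimalPeriod σ f, fun j hj hjp =>
      Function.not_isPeriodicPt_of_pos_of_lt_minimalPeriod hj.ne' hjp⟩
  set DW : Finset G.Dart := univ.filter fun g => g.edge ∈ W with hDW
  have h1 : Function.minimalPeriod σ f ≤ DW.card := by
    have himg : (range (Function.minimalPeriod σ f)).image (fun j => σ^[j] f) ⊆ DW := by
      intro g hg
      obtain ⟨j, -, rfl⟩ := mem_image.1 hg
      exact mem_filter.2 ⟨mem_univ _, iterate_edge_mem h j hf⟩
    have := card_le_card himg
    rwa [card_image_of_injOn, card_range] at this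
    have := Function.iterate_injOn_Iio_minimalPeriod (f := σ) (x := f)
    rwa [coe_range]
  refine h1.trans (card_le_mul_card_image_of_maps_to (f := fun g : G.Dart => g.edge)
    (fun g hg => (mem_filter.1 hg).2) 2 ?_)
  intro e _
  refine (card_le_card (filter_subset_filter _ (subset_univ _))).trans ?_
  by_cases he : e ∈ G.edgeSet
  · exact (G.dart_edge_fiber_card e he).le
  · rw [filter_false_of_mem]
    · simp
    · rintro g - rfl
      exact he g.edge_mem

/-- The node `v` has got hold of the key of `e` before round `t`. -/
def Holds (carry : ℕ → G.Dart → Option G.Dart) (t : ℕ) (v : V) (e : G.Dart) : Prop :=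
  e.fst = v ∨ ∃ i < t, ∃ f : G.Dart, f.snd = v ∧ carry i f = some e

/-- A schedule for sending a key for every dart `e` from `e.fst` to `e.snd` without using the
edge of `e`, in `T` rounds and with at most one key per dart and round: in round `t`, the key of
`carry t f` is sent along `f`. -/
structure IsSchedule (carry : ℕ → G.Dart → Option G.Dart) (T : ℕ) : Prop where
  avoids : ∀ t f e, carry t f = some e → f.edge ≠ e.edge
  holds : ∀ t f e, carry t f = some e → Holds carry t f.fst e
  arrives : ∀ e, Holds carry T e.snd e

/-- The key of `e` follows the trail of `e.symm`, without `e.symm` itself: this leads from `e.fst`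
to `e.snd` and avoids the edge of `e` in both orientations. Time is cut into frames of `c` rounds,
and every key makes one step per frame. Since the trail maps are injective, at most one key per
member of `L` wants a given dart in a given frame, so `c` slots are enough. -/
theorem exists_schedule {L : Multiset (Finset (Sym2 V))} {D c : ℕ} (hL : IsEvenFamily G L D c)
    (hcov : ∀ e ∈ G.edgeSet, ∃ W ∈ L, e ∈ W) :
    ∃ carry : ℕ → G.Dart → Option G.Dart, IsSchedule carry (2 * D * c) := by
  have hσ : ∀ i : L, ∃ σ : G.Dart → G.Dart, Function.Injective σ ∧ ∀ f, f.edge ∈ i.1 →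
      (σ f).edge ∈ i.1 ∧ (σ f).fst = f.snd ∧ ∀ k, σ^[k] f ≠ f.symm := fun i =>
    exists_trail_decomposition (hL.1 i.1 (Multiset.coe_mem)).2.1 (hL.1 i.1 (Multiset.coe_mem)).1
  choose σ hinj hσ using hσ
  have hidx : ∀ e : G.Dart, ∃ i : L, e.edge ∈ i.1 := fun e => by
    obtain ⟨W, hW, he⟩ := hcov _ e.edge_mem
    exact ⟨L.mkToType W ⟨0, Multiset.count_pos.2 hW⟩, he⟩
  choose idx hidx using hidx
  have hidx' : ∀ e : G.Dart, e.symm.edge ∈ (idx e).1 := fun e => by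
    rw [SimpleGraph.Dart.edge_symm]
    exact hidx e
  have hper := fun e : G.Dart => exists_period_le (hinj (idx e)) (fun f hf => (hσ (idx e) f hf).1)
    (hidx' e)
  choose p hp0 hpW hpp hpm using hper
  have hpD : ∀ e, p e ≤ 2 * D := fun e =>
    (hpW e).trans (Nat.mul_le_mul_left 2 (hL.1 _ Multiset.coe_mem).2.2)
  -- The keys due on `f` in frame `j`. The exponent is `j + 1` because `e.symm` is skipped; `j + 1 <
  -- p e` stops the key before the trail returns to it.
  set S : ℕ → G.Dart → Finset G.Dart := fun j f => univ.filter fun e =>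
    j + 1 < p e ∧ (σ (idx e))^[j + 1] e.symm = f with hS
  have hSc : ∀ j f, (S j f).card ≤ c := by
    intro j f
    have h1 : (univ.filter fun i : L => f.edge ∈ i.1).card ≤ c := by
      refine le_trans (le_of_eq ?_) (hL.2 f.edge)
      conv_rhs => rw [← L.map_univ_coe, Multiset.countP_map]
      rw [card_def, filter_val]
    refine le_trans (card_le_card_of_injOn idx ?_ ?_) h1
    · intro e he
      obtain ⟨-, hef⟩ := (mem_filter.1 he).2
      refine mem_coe.2 (mem_filter.2 ⟨mem_univ _, ?_⟩)
      rw [← hef]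
      exact iterate_edge_mem (fun f hf => (hσ (idx e) f hf).1) _ (hidx' e)
    · intro e he e' he' hee
      obtain ⟨-, h2⟩ := (mem_filter.1 he).2
      obtain ⟨-, h3⟩ := (mem_filter.1 he').2
      rw [← hee] at h3
      exact SimpleGraph.Dart.symm_involutive.injective
        ((hinj (idx e)).iterate (j + 1) (h2.trans h3.symm))
  set carry : ℕ → G.Dart → Option G.Dart := fun t f => (S (t / c) f).toList[t % c]? with hcarry
  have hmem : ∀ t f e, carry t f = some e → e ∈ S (t / c) f := fun t f e h =>
    mem_toList.1 (List.mem_of_getElem? h)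
  have hslot : ∀ j f e, e ∈ S j f → ∃ i < (j + 1) * c, carry i f = some e := by
    intro j f e he
    obtain ⟨k, hk, hke⟩ := List.mem_iff_getElem.1 (mem_toList.2 he)
    have hkc : k < c := by
      rw [length_toList] at hk
      exact hk.trans_le (hSc j f)
    refine ⟨k + c * j, ?_, ?_⟩
    · rw [add_mul, mul_comm j c]
      omega
    · simp only [hcarry]
      rw [Nat.add_mul_div_left _ _ (by omega), Nat.div_eq_of_lt hkc, zero_add,
        Nat.add_mul_mod_self_left, Nat.mod_eq_of_lt hkc, List.getElem?_eq_getElem hk, hke]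
  have hnext : ∀ e j, ((σ (idx e))^[j + 1] e.symm).fst = ((σ (idx e))^[j] e.symm).snd := by
    intro e j
    rw [Function.iterate_succ_apply']
    exact (hσ (idx e) _ (iterate_edge_mem (fun f hf => (hσ (idx e) f hf).1) _ (hidx' e))).2.1
  refine ⟨carry, ⟨?_, ?_, ?_⟩⟩
  · intro t f e h hfe
    obtain ⟨h1, h2⟩ := (mem_filter.1 (hmem t f e h)).2
    rcases (SimpleGraph.dart_edge_eq_iff f e).1 hfe with rfl | rfl
    · refine (hσ (idx f) _ (hidx' f)).2.2 (t / c + 1) ?_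
      rw [h2, SimpleGraph.Dart.symm_symm]
    · exact hpm e _ (Nat.succ_pos _) h1 h2
  · intro t f e h
    obtain ⟨h1, h2⟩ := (mem_filter.1 (hmem t f e h)).2
    rcases hj : t / c with _ | j
    · left
      rw [hj] at h2
      rw [← h2]
      exact (hnext e 0).symm
    · right
      rw [hj] at h1 h2
      obtain ⟨i, hi, hic⟩ := hslot j ((σ (idx e))^[j + 1] e.symm) e
        (mem_filter.2 ⟨mem_univ _, by omega, rfl⟩)
      refine ⟨i, hi.trans_le ?_, _, ?_, hic⟩
      · rw [← hj]
        exact Nat.div_mul_le_self t c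
      · rw [← h2, hnext e (j + 1)]
  · intro e
    right
    have h2 : 2 ≤ p e := by
      by_contra! hlt
      have h1 : p e = 1 := by
        have := hp0 e
        omega
      have h3 := hpp e
      have h4 := hnext e 0
      rw [h1] at h3
      simp only [zero_add, h3, Function.iterate_zero, id] at h4
      exact e.symm.fst_ne_snd h4
    obtain ⟨i, hi, hic⟩ := hslot (p e - 2) ((σ (idx e))^[p e - 2 + 1] e.symm) e
        (mem_filter.2 ⟨mem_univ _, by omega, rfl⟩)
    refine ⟨i, hi.trans_le ?_, _, ?_, hic⟩
    · refine Nat.mul_le_mul_right c ?_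
      have := hpD e
      omega
    · rw [← hnext e (p e - 2 + 1), show p e - 2 + 1 + 1 = p e by omega, hpp]
      rfl

end

/-! ### Secret sharing, the compiled program and its correctness -/

section
open scoped Classical
open Finset

/-- The `j`-th of `T` shares of `M`: all but the last one are given by `c`, and the sum of all shares
and of the key `c (T - 1)` is `M`. -/
def shareOf {Z : Type} [AddCommGroup Z] (T : ℕ) (c : ℕ → Z) (M : Z) (j : ℕ) : Z :=
  if j + 1 < T then c j else M - ∑ i ∈ range T, c i

theorem sum_shareOf {Z : Type} [AddCommGroup Z] {T : ℕ} (hT : 0 < T) (c : ℕ → Z) (M : Z) :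
    ∑ j ∈ range T, shareOf T c M j + c (T - 1) = M := by
  obtain ⟨T, rfl⟩ := Nat.exists_eq_succ_of_ne_zero hT.ne'
  have h : ∑ j ∈ range T, shareOf (T + 1) c M j = ∑ j ∈ range T, c j :=
    sum_congr rfl fun j hj => if_pos (Nat.succ_lt_succ (mem_range.1 hj))
  rw [Nat.succ_eq_add_one, sum_range_succ, h, shareOf, if_neg (lt_irrefl _), sum_range_succ,
    Nat.add_sub_cancel]
  abel

/-- Here `w j` says that round `j` is watched and `δ` is the change of the message. If the last
round is unwatched, the last share absorbs `δ` and no coin changes. If it is watched but an earlier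
round is not, the coin of that earlier round takes `δ`. If all rounds are watched, the key `c (T -
1)` takes it. -/
theorem exists_correction {Z : Type} [AddCommGroup Z] {T : ℕ} (hT : 0 < T) (w : ℕ → Prop) (δ : Z) :
    ∃ D : ℕ → Z, (∀ j, j + 1 < T → w j → D j = 0) ∧ (w (T - 1) → ∑ i ∈ range T, D i = δ) ∧
      (D (T - 1) ≠ 0 → ∀ j < T, w j) := by
  have hsum : ∀ k < T, ∑ i ∈ range T, (Pi.single k δ : ℕ → Z) i = δ := fun k hk => by
    simp [Pi.single_apply, hk]
  by_cases hall : ∀ j < T, w j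
  · exact ⟨Pi.single (T - 1) δ, fun j hj _ => Pi.single_eq_of_ne (by omega) _,
      fun _ => hsum _ (by omega), fun _ => hall⟩
  · push Not at hall
    obtain ⟨k, hk, hwk⟩ := hall
    by_cases hlast : w (T - 1)
    · have hne : k ≠ T - 1 := fun h => hwk (h ▸ hlast)
      refine ⟨Pi.single k δ, fun j _ hj => Pi.single_eq_of_ne (by rintro rfl; exact hwk hj) _,
        fun _ => hsum k hk, fun h => absurd (Pi.single_eq_of_ne hne.symm _) h⟩
    · exact ⟨0, fun _ _ _ => rfl, fun h => absurd h hlast, fun h => absurd rfl h⟩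

/-- Shares for hiding messages of at most `b` bits in messages of at most `b'` bits. -/
structure Coding (b b' : ℕ) (Z : Type) where
  enc : Msg b → Z
  dec : Z → Msg b
  dec_enc : ∀ l, dec (enc l) = l
  pack : Z × Z → Msg b'
  unpack : Msg b' → Z × Z
  unpack_pack : ∀ z, unpack (pack z) = z

/-- Two bits per position, presence and value, encode messages of varying length. A share together
with a key then takes `4 * b` bits. -/
theorem exists_coding {b b' : ℕ} (h : 4 * b ≤ b') :
    Nonempty (Coding b b' (Fin b × Bool → ZMod 2)) := by
  let enc : Msg b → Fin b × Bool → ZMod 2 := fun l i =>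
    if i.2 then (if (i.1 : ℕ) < l.1.length then 1 else 0)
    else (if l.1[(i.1 : ℕ)]? = some true then 1 else 0)
  have henc : Function.Injective enc := by
    intro l l' hll
    apply Subtype.ext
    apply List.ext_getElem?
    intro i
    by_cases hi : i < b
    · have h1 := congrFun hll (⟨i, hi⟩, true)
      have h2 := congrFun hll (⟨i, hi⟩, false)
      simp only [enc, if_true, Bool.false_eq_true, if_false] at h1 h2
      have h1' : i < l.1.length ↔ i < l'.1.length := by
        split_ifs at h1 <;> first | omega | exact absurd h1 (by decide)
      have h2' : l.1[i]? = some true ↔ l'.1[i]? = some true := by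
        by_cases ha : l.1[i]? = some true <;> by_cases hb : l'.1[i]? = some true <;> simp_all
      by_cases hl : i < l.1.length
      · have hl' := h1'.1 hl
        rw [List.getElem?_eq_getElem hl, List.getElem?_eq_getElem hl'] at h2' ⊢
        simp only [Option.some.injEq] at h2' ⊢
        exact Bool.eq_iff_iff.2 h2'
      · rw [List.getElem?_eq_none (by omega), List.getElem?_eq_none (by omega)]
    · have h1 := l.2
      have h2 := l'.2
      rw [List.getElem?_eq_none (by omega), List.getElem?_eq_none (by omega)]
  let φ : (Fin b × Bool → ZMod 2) × (Fin b × Bool → ZMod 2) ≃ (Fin (4 * b) → Bool) :=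
    Fintype.equivOfCardEq (by
      simp only [Fintype.card_prod, Fintype.card_fun, Fintype.card_fin, Fintype.card_bool, ZMod.card]
      rw [← pow_add]
      congr 1
      ring)
  let pack : (Fin b × Bool → ZMod 2) × (Fin b × Bool → ZMod 2) → Msg b' := fun z =>
    ⟨List.ofFn (φ z), by rwa [List.length_ofFn]⟩
  have hpack : Function.Injective pack := fun z z' hz =>
    φ.injective (List.ofFn_injective (congrArg Subtype.val hz))
  have : Nonempty (Msg b) := ⟨⟨[], Nat.zero_le _⟩⟩
  exact ⟨⟨enc, Function.invFun enc, Function.leftInverse_invFun henc, pack, Function.invFun pack,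
    Function.leftInverse_invFun hpack⟩⟩

variable {V : Type} {G : SimpleGraph V} {b b' r T m : ℕ} {Z : Type} [AddCommGroup Z]

/-- Read the `j`-th coin of phase `p` for the neighbour `u`. -/
noncomputable def coin (κ : Fin r × V × Fin T → Z) (p : ℕ) (u : V) (j : ℕ) : Z :=
  if h : p < r ∧ j < T then κ (⟨p, h.1⟩, u, ⟨j, h.2⟩) else 0

/-- The state of a node of the compiled algorithm: the number of rounds that have passed, the state
in the simulated algorithm, the coins, the sums of the shares that have been received in the
current phase, and the known keys of the current phase. -/
structure PhaseState (G : SimpleGraph V) (v : V) (r T : ℕ) (Z S : Type) where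
  round : ℕ
  inner : S
  coins : Fin r × V × Fin T → Z
  acc : G.neighborSet v → Z
  keys : G.Dart → Z

/-- The key of the dart `e` in phase `p`, one of the coins of `e.fst`. -/
noncomputable def keyOf (κ : V → Fin r × V × Fin T → Z) (p : ℕ) (e : G.Dart) : Z :=
  coin (κ e.fst) p e.snd (T - 1)

/-- The value 0 is a placeholder: `PhaseInvariant` speaks only about keys that the node `Holds`. -/
noncomputable def ownKeys (v : V) (κ : Fin r × V × Fin T → Z) (p : ℕ) (e : G.Dart) : Z :=
  if e.fst = v then coin κ p e.snd (T - 1) else 0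

/-- The dart from a neighbour `u` of `v` to `v`. -/
def dartFrom {v : V} (u : G.neighborSet v) : G.Dart := ⟨(u.1, v), G.adj_symm u.2⟩

/-- The dart from `v` to a neighbour `u` of `v`. -/
def dartTo {v : V} (u : G.neighborSet v) : G.Dart := ⟨(v, u.1), u.2⟩

/-- The sums of the received shares after the messages of the current round. -/
def PhaseState.newAcc {v : V} {S : Type} (cd : Coding b b' Z) (s : PhaseState G v r T Z S)
    (msgs : G.neighborSet v → Msg b') (u : G.neighborSet v) : Z :=
  s.acc u + (cd.unpack (msgs u)).1

/-- The known keys after the messages of the current round. -/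
noncomputable def PhaseState.newKeys {v : V} {S : Type} (cd : Coding b b' Z)
    (carry : ℕ → G.Dart → Option G.Dart) (s : PhaseState G v r T Z S)
    (msgs : G.neighborSet v → Msg b') (e : G.Dart) : Z :=
  if h : ∃ u : G.neighborSet v, carry (s.round % T) (dartFrom u) = some e
    then (cd.unpack (msgs h.choose)).2 else s.keys e

/-- The compiled program simulates every round of `P` by a phase of `T` rounds. In every round of a
phase it sends over each edge a share of the message of `P` and the key that `carry` prescribes. -/
noncomputable def compileNode (cd : Coding b b' Z) (carry : ℕ → G.Dart → Option G.Dart)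
    (rd : (Fin m → Bool) → Fin r × V × Fin T → Z) (v : V) {X Y : Type}
    (P : NodeProgram b (G.neighborSet v) X Y) :
    NodeProgram b' (G.neighborSet v) (X × (Fin m → Bool)) Y where
  State := PhaseState G v r T Z P.State
  init x := ⟨0, P.init x.1, rd x.2, 0, ownKeys v (rd x.2) 0⟩
  send s u := cd.pack
    (shareOf T (coin s.coins (s.round / T) u.1) (cd.enc (P.send s.inner u)) (s.round % T),
      (carry (s.round % T) (dartTo u)).elim 0 s.keys)
  next s msgs :=
    if (s.round + 1) % T = 0 then
      ⟨s.round + 1, P.next s.inner fun u =>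
        cd.dec (s.newAcc cd msgs u + s.newKeys cd carry msgs (dartFrom u)), s.coins, 0,
        ownKeys v s.coins ((s.round + 1) / T)⟩
    else ⟨s.round + 1, s.inner, s.coins, s.newAcc cd msgs, s.newKeys cd carry msgs⟩
  output s := P.output s.inner

variable {X Y : V → Type} (cd : Coding b b' Z) {carry : ℕ → G.Dart → Option G.Dart}
  (rd : (Fin m → Bool) → Fin r × V × Fin T → Z) (A : Algorithm G b X Y)

/-- The message on the dart `f` in round `t` of the compiled algorithm. -/
noncomputable def phaseMessage (carry : ℕ → G.Dart → Option G.Dart) (x : ∀ v, X v)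
    (κ : V → Fin r × V × Fin T → Z) (t : ℕ) (f : G.Dart) : Msg b' :=
  cd.pack (shareOf T (coin (κ f.fst) (t / T) f.snd) (cd.enc (A.message x (t / T) f)) (t % T),
    (carry (t % T) f).elim 0 (keyOf κ (t / T)))

/-- What holds for the state of `v` after `t` rounds of the compiled algorithm. -/
structure PhaseInvariant (carry : ℕ → G.Dart → Option G.Dart) (x : ∀ v, X v)
    (κ : V → Fin r × V × Fin T → Z) (t : ℕ) (v : V) (s : PhaseState G v r T Z (A v).State) :
    Prop where
  round : s.round = t
  inner : s.inner = A.state x (t / T) v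
  coins : s.coins = κ v
  acc : ∀ u : G.neighborSet v, s.acc u = ∑ i ∈ range (t % T),
    shareOf T (coin (κ u) (t / T) v) (cd.enc (A.message x (t / T) (dartFrom u))) i
  keys : ∀ e, Holds carry (t % T) v e → s.keys e = keyOf κ (t / T) e

theorem div_mod_succ (hT : 0 < T) (t : ℕ) :
    ((t + 1) % T = 0 → t % T + 1 = T ∧ (t + 1) / T = t / T + 1) ∧
      ((t + 1) % T ≠ 0 → (t + 1) % T = t % T + 1 ∧ (t + 1) / T = t / T) := by
  have h1 := Nat.div_add_mod t T
  have h2 := Nat.mod_lt t hT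
  by_cases h : t % T + 1 = T
  · have h3 : t + 1 = 0 + T * (t / T + 1) := by rw [mul_add]; omega
    have h4 : (t + 1) % T = 0 := by rw [h3, Nat.add_mul_mod_self_left, Nat.zero_mod]
    have h5 : (t + 1) / T = t / T + 1 := by
      conv_lhs => rw [h3, Nat.add_mul_div_left _ _ hT, Nat.zero_div, zero_add]
    exact ⟨fun _ => ⟨h, h5⟩, fun h' => absurd h4 h'⟩
  · have h3 : t + 1 = (t % T + 1) + T * (t / T) := by omega
    have h4 : (t + 1) % T = t % T + 1 := by
      conv_lhs => rw [h3, Nat.add_mul_mod_self_left, Nat.mod_eq_of_lt (by omega)]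
    have h5 : (t + 1) / T = t / T := by
      conv_lhs => rw [h3, Nat.add_mul_div_left _ _ hT, Nat.div_eq_of_lt (by omega), zero_add]
    exact ⟨fun h' => by omega, fun _ => ⟨h4, h5⟩⟩

variable {rd A}

theorem PhaseInvariant.send_eq {x : ∀ v, X v} {κ : V → Fin r × V × Fin T → Z} {t : ℕ} {f : G.Dart}
    {s : PhaseState G f.fst r T Z (A f.fst).State}
    (hs : IsSchedule carry T) (h : PhaseInvariant cd A carry x κ t f.fst s) :
    (compileNode cd carry rd f.fst (A f.fst)).send s ⟨f.snd, f.adj⟩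
      = phaseMessage cd A carry x κ t f := by
  simp only [compileNode, phaseMessage, h.round, h.coins, h.inner]
  congr 2
  change (carry (t % T) f).elim 0 s.keys = _
  cases hc : carry (t % T) f with
  | none => rfl
  | some e => exact h.keys e (hs.holds _ _ _ hc)

variable (rd A)

theorem phaseInvariant (hT : 0 < T) (hs : IsSchedule carry T) (x : ∀ v, X v)
    (κ : V → Fin m → Bool) (t : ℕ) (v : V) :
    PhaseInvariant cd A carry x (fun v => rd (κ v)) t v
      (Algorithm.state (fun v => compileNode cd carry rd v (A v)) (fun v => (x v, κ v)) t v) := by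
  induction t generalizing v with
  | zero =>
    refine ⟨rfl, ?_, rfl, ?_, ?_⟩
    · rw [Nat.zero_div]
      rfl
    · intro u
      rw [Nat.zero_mod]
      rfl
    · rintro e (rfl | ⟨i, hi, -⟩)
      · rw [Nat.zero_div]
        exact if_pos rfl
      · rw [Nat.zero_mod] at hi
        omega
  | succ t ih =>
    set s : PhaseState G v r T Z (A v).State := Algorithm.state (fun v => compileNode cd carry rd v (A v)) (fun v => (x v, κ v)) t v
      with hsdef
    have hv := ih v
    set msgs : G.neighborSet v → Msg b' := fun u =>
      phaseMessage cd A carry x (fun v => rd (κ v)) t (dartFrom u) with hmsgs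
    have hstep : Algorithm.state (fun v => compileNode cd carry rd v (A v)) (fun v => (x v, κ v))
        (t + 1) v = (compileNode cd carry rd v (A v)).next s msgs := by
      change (compileNode cd carry rd v (A v)).next s _ = _
      congr 1
      funext u
      exact PhaseInvariant.send_eq (f := dartFrom u) cd hs (ih u.1)
    have hr : s.round = t := hv.round
    have hacc : ∀ u : G.neighborSet v, s.newAcc cd msgs u =
        ∑ i ∈ range (t % T + 1), shareOf T (coin (rd (κ u)) (t / T) v)
          (cd.enc (A.message x (t / T) (dartFrom u))) i := by
      intro u
      rw [PhaseState.newAcc, sum_range_succ, hv.acc u, hmsgs]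
      simp only [phaseMessage, cd.unpack_pack]
      rfl
    have hkeys : ∀ e, Holds carry (t % T + 1) v e →
        s.newKeys cd carry msgs e = keyOf (fun v => rd (κ v)) (t / T) e := by
      intro e he
      rw [PhaseState.newKeys]
      simp only [hr]
      -- Several neighbours may deliver the same key. All of them send the right value, so the
      -- choice does not matter.
      split_ifs with h
      · have hc := h.choose_spec
        simp only [hmsgs, phaseMessage, cd.unpack_pack, hc, Option.elim_some]
      · apply hv.keys
        rcases he with he | ⟨i, hi, f, hf, hfe⟩
        · exact Or.inl he
        · refine Or.inr ⟨i, ?_, f, hf, hfe⟩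
          rcases Nat.lt_succ_iff_lt_or_eq.1 hi with hi | rfl
          · exact hi
          · subst hf
            exact absurd ⟨⟨f.fst, G.adj_symm f.adj⟩, hfe⟩ h
    rw [hstep]
    obtain ⟨hd0, hd1⟩ := div_mod_succ hT t
    by_cases h0 : (t + 1) % T = 0
    · obtain ⟨hj, hp⟩ := hd0 h0
      have hnext : (compileNode cd carry rd v (A v)).next s msgs = ⟨s.round + 1,
          (A v).next s.inner fun u =>
            cd.dec (s.newAcc cd msgs u + s.newKeys cd carry msgs (dartFrom u)), s.coins, 0,
          ownKeys v s.coins ((s.round + 1) / T)⟩ := if_pos (by rw [hr]; exact h0)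
      rw [hnext]
      refine ⟨by simp only [hr], ?_, hv.coins, ?_, ?_⟩
      · rw [hp]
        rw [show s.inner = A.state x (t / T) v from hv.inner, Algorithm.state]
        change (A v).next (A.state x (t / T) v) _ = (A v).next (A.state x (t / T) v) _
        congr 1
        funext u
        -- At the end of the phase the key has arrived along its detour, and with the sum of all `T`
        -- shares it gives the message.
        have hk := hkeys (dartFrom u) (by rw [hj]; exact hs.arrives (dartFrom u))
        rw [hk, hacc u, hj]
        have := sum_shareOf hT (coin (rd (κ u)) (t / T) v)
          (cd.enc (A.message x (t / T) (dartFrom u)))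
        change cd.dec (_ + coin (rd (κ u)) (t / T) v (T - 1)) = _
        rw [this, cd.dec_enc]
        rfl
      · intro u
        rw [h0]
        rfl
      · rintro e (rfl | ⟨i, hi, -⟩)
        · simp only [hr, show s.coins = rd (κ e.fst) from hv.coins]
          exact if_pos rfl
        · omega
    · obtain ⟨hj, hp⟩ := hd1 h0
      have hnext : (compileNode cd carry rd v (A v)).next s msgs = ⟨s.round + 1, s.inner, s.coins,
          s.newAcc cd msgs, s.newKeys cd carry msgs⟩ := if_neg (by rw [hr]; exact h0)
      rw [hnext]
      refine ⟨by simp only [hr], ?_, hv.coins, ?_, ?_⟩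
      · rw [hp]
        exact hv.inner
      · intro u
        rw [hp, hj]
        exact hacc u
      · intro e he
        rw [hj] at he
        rw [hp]
        exact hkeys e he

theorem message_compile (hT : 0 < T) (hs : IsSchedule carry T) (x : ∀ v, X v)
    (κ : V → Fin m → Bool) (t : ℕ) (f : G.Dart) :
    Algorithm.message (fun v => compileNode cd carry rd v (A v)) (fun v => (x v, κ v)) t f
      = phaseMessage cd A carry x (fun v => rd (κ v)) t f :=
  PhaseInvariant.send_eq cd hs (phaseInvariant cd rd A hT hs x κ t f.fst)

theorem result_compile (hT : 0 < T) (hs : IsSchedule carry T) (x : ∀ v, X v)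
    (κ : V → Fin m → Bool) (k : ℕ) (v : V) :
    Algorithm.result (fun v => compileNode cd carry rd v (A v)) (fun v => (x v, κ v)) (k * T) v
      = A.result x k v := by
  have h := (phaseInvariant cd rd A hT hs x κ (k * T) v).inner
  rw [Nat.mul_div_cancel _ hT] at h
  exact congrArg (A v).output h

end

/-! ### Perfect security -/

section
open scoped Classical
open Finset

variable {V : Type} {G : SimpleGraph V} {b b' r T m : ℕ} {Z : Type} [AddCommGroup Z]
  {X Y : V → Type}

/-- Changing the inputs can be compensated by changing the coins: in each phase and for each dart,
the eavesdropper misses one of the shares or the key, and this one is corrected. -/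
theorem exists_coin_shift (cd : Coding b b' Z) {carry : ℕ → G.Dart → Option G.Dart}
    (rd : (Fin m → Bool) ≃ (Fin r × V × Fin T → Z)) (A : Algorithm G b X Y) (hT : 0 < T)
    (hs : IsSchedule carry T) (E : Eavesdropper G b') (x x' : ∀ v, X v) :
    ∃ θ : (V → Fin m → Bool) → V → Fin m → Bool, Function.Injective θ ∧ ∀ κ,
      view (fun v => compileNode cd carry rd v (A v)) (fun v => (x' v, θ κ v)) E (r * T)
        = view (fun v => compileNode cd carry rd v (A v)) (fun v => (x v, κ v)) E (r * T) := by
  choose corr hcorr₁ hcorr₂ hcorr₃ using fun (w : ℕ → Prop) (δ : Z) => exists_correction hT w δ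
  set seen : (∀ v, X v) → (V → Fin m → Bool) → ℕ → List (Observation G b') := fun x κ =>
    view (fun v => compileNode cd carry rd v (A v)) (fun v => (x v, κ v)) E with hseen
  set watch : (V → Fin m → Bool) → ℕ → G.Dart → ℕ → Prop := fun κ p f j =>
    j < T ∧ (E (seen x κ (p * T + j))).edge = f.edge with hwatch
  -- The messages of `A` do not involve the additional coins, so `D` depends on `κ` only through the
  -- rounds in which the edge is watched.
  set D : (V → Fin m → Bool) → ℕ → G.Dart → ℕ → Z := fun κ p f =>
    corr (watch κ p f) (cd.enc (A.message x' p f) - cd.enc (A.message x p f)) with hD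
  set θ' : (V → Fin m → Bool) → V → Fin r × V × Fin T → Z := fun κ v i =>
    rd (κ v) i + if h : G.Adj v i.2.1 then D κ i.1 ⟨(v, i.2.1), h⟩ i.2.2 else 0 with hθ'
  set θ : (V → Fin m → Bool) → V → Fin m → Bool := fun κ v => rd.symm (θ' κ v) with hθ
  have hcoin : ∀ κ p j (f : G.Dart), p < r → j < T →
      coin (rd (θ κ f.fst)) p f.snd j = coin (rd (κ f.fst)) p f.snd j + D κ p f j := by
    intro κ p j f hp hj
    simp only [coin, hp, hj, and_self, dif_pos, hθ, Equiv.apply_symm_apply, hθ', f.adj]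
  have hmsg : ∀ κ t (f : G.Dart), t < r * T → (E (seen x κ t)).edge = f.edge →
      phaseMessage cd A carry x' (fun v => rd (θ κ v)) t f
        = phaseMessage cd A carry x (fun v => rd (κ v)) t f := by
    intro κ t f ht hf
    have hp : t / T < r := Nat.div_lt_of_lt_mul (by rwa [mul_comm])
    have hj : t % T < T := Nat.mod_lt t hT
    have hpj : t / T * T + t % T = t := Nat.div_add_mod' t T
    have hw : watch κ (t / T) f (t % T) := ⟨hj, by rw [hpj]; exact hf⟩
    unfold phaseMessage
    congr 2
    · unfold shareOf
      split_ifs with hlast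
      · rw [hcoin κ _ _ f hp hj]
        rw [show D κ (t / T) f (t % T) = 0 from hcorr₁ _ _ _ hlast hw, add_zero]
      · have hjT : t % T = T - 1 := by omega
        rw [hjT] at hw
        rw [sum_congr rfl fun i hi => hcoin κ _ _ f hp (mem_range.1 hi), sum_add_distrib,
          show ∑ i ∈ range T, D κ (t / T) f i = _ from hcorr₂ _ _ hw]
        abel
    · cases hc : carry (t % T) f with
      | none => rfl
      | some e =>
        change coin (rd (θ κ e.fst)) _ _ _ = coin (rd (κ e.fst)) _ _ _
        rw [hcoin κ _ _ e hp (by omega)]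
        -- The key of `e` is altered only if the edge of `e` is watched throughout the phase. But in
        -- this round the edge of `f` is watched, and `f` carries the key of `e`, so the two edges
        -- differ.
        have : D κ (t / T) e (T - 1) = 0 := by
          by_contra hne
          have := (hcorr₃ _ _ hne (t % T) hj).2
          rw [hpj, hf] at this
          exact hs.avoids _ _ _ hc this
        rw [this, add_zero]
  have hview : ∀ κ t, t ≤ r * T → seen x' (θ κ) t = seen x κ t := by
    intro κ t
    induction t with
    | zero => exact fun _ => rfl
    | succ t ih =>
      intro ht
      have h := ih (by omega)
      have hunf : ∀ y κ, seen y κ (t + 1) = (E (seen y κ t),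
          phaseMessage cd A carry y (fun v => rd (κ v)) t (E (seen y κ t)),
          phaseMessage cd A carry y (fun v => rd (κ v)) t (E (seen y κ t)).symm) :: seen y κ t := by
        intro y κ
        rw [← message_compile cd rd A hT hs, ← message_compile cd rd A hT hs]
        rfl
      rw [hunf, hunf, h, hmsg κ t _ (by omega) rfl,
        hmsg κ t _ (by omega) (SimpleGraph.Dart.edge_symm _).symm]
  refine ⟨θ, fun κ₁ κ₂ h12 => ?_, fun κ => hview κ _ le_rfl⟩
  -- The new coins determine the view, the view determines the watched rounds and thus the
  -- corrections, and subtracting these recovers the old coins.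
  have hsame : ∀ t ≤ r * T, seen x κ₁ t = seen x κ₂ t := fun t ht => by
    rw [← hview κ₁ t ht, h12, hview κ₂ t ht]
  have hDD : ∀ p < r, ∀ f, D κ₁ p f = D κ₂ p f := by
    intro p hp f
    have : watch κ₁ p f = watch κ₂ p f := by
      funext j
      simp only [hwatch]
      refine propext (and_congr_right fun hj => ?_)
      rw [hsame]
      have := Nat.mul_le_mul_right T (show p + 1 ≤ r from hp)
      rw [add_mul, one_mul] at this
      omega
    simp only [hD, this]
  funext v
  apply rd.injective
  funext i
  have h := congrFun (rd.symm.injective (congrFun h12 v)) i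
  simp only [hθ'] at h
  simp only [hDD i.1 i.1.2] at h
  exact add_right_cancel h

theorem map_uniformOfFintype_of_injective {α : Type} [Fintype α] [Nonempty α] {θ : α → α}
    (hθ : Function.Injective θ) :
    (PMF.uniformOfFintype α).map θ = PMF.uniformOfFintype α := by
  ext y
  obtain ⟨z, rfl⟩ := (Finite.injective_iff_surjective.1 hθ) y
  rw [PMF.map_apply, tsum_eq_single z]
  · simp
  · intro z' hz'
    rw [if_neg fun h => hz' (hθ h.symm)]

end

theorem viewLaw_compileNode_eq {V : Type} [Fintype V] [DecidableEq V] {G : SimpleGraph V}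
    {b b' r T m : ℕ} {Z : Type} [AddCommGroup Z] {X Y : V → Type} (cd : Coding b b' Z)
    {carry : ℕ → G.Dart → Option G.Dart} (rd : (Fin m → Bool) ≃ (Fin r × V × Fin T → Z))
    (A : Algorithm G b X Y) (hT : 0 < T) (hs : IsSchedule carry T) (E : Eavesdropper G b')
    (x x' : ∀ v, X v) :
    viewLaw (fun v => compileNode cd carry rd v (A v)) x E (r * T)
      = viewLaw (fun v => compileNode cd carry rd v (A v)) x' E (r * T) := by
  obtain ⟨θ, hθ, h⟩ := exists_coin_shift cd rd A hT hs E x x'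
  unfold viewLaw
  conv_rhs => rw [← map_uniformOfFintype_of_injective hθ, PMF.map_comp]
  congr 1
  funext κ
  exact (h κ).symm

/-! ### Networks without edges, the bound on the rounds, and assembly -/

/-- The program that simulates `r` rounds of a node without neighbours before the first round. -/
def simulateIsolated {b b' m : ℕ} (r : ℕ) {N X Y : Type} (P : NodeProgram b N X Y) :
    NodeProgram b' N (X × (Fin m → Bool)) Y where
  State := P.State
  init x := (fun s => P.next s fun _ => ⟨[], Nat.zero_le _⟩)^[r] (P.init x.1)
  send _ _ := ⟨[], Nat.zero_le _⟩
  next s _ := s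
  output := P.output

theorem state_of_edgeless {V : Type} {G : SimpleGraph V} (hG : ∀ u v, ¬ G.Adj u v) {b : ℕ}
    {X Y : V → Type} (A : Algorithm G b X Y) (x : ∀ v, X v) (t : ℕ) (v : V) :
    A.state x t v
      = (fun s => (A v).next s fun _ => ⟨[], Nat.zero_le _⟩)^[t] ((A v).init (x v)) := by
  induction t with
  | zero => rfl
  | succ t ih =>
    rw [Function.iterate_succ_apply', ← ih]
    change (A v).next _ _ = (A v).next _ _
    congr 1
    funext u
    exact absurd u.2 (hG v u)

/-- The schedule needs only `O(d log⁴ n)` rounds; the summand `c` merely weakens the bound. The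
constant is `2 * 7 * 15 * 780`. -/
theorem trail_rounds_le {d l : ℕ} (hd : 1 ≤ d) (hl : 1 ≤ l) (c : ℕ) :
    2 * ((4 * l + 3) * (1 + 2 * (2 * d * (2 * l + 1) + 1))) * (780 * l ^ 2)
      ≤ 163800 * (d + c) * l ^ 4 := by
  have hdl : 1 ≤ d * l := Nat.mul_pos hd hl
  have h1 : 4 * l + 3 ≤ 7 * l := by omega
  have h2 : 1 + 2 * (2 * d * (2 * l + 1) + 1) ≤ 15 * (d * l) := by
    have : d ≤ d * l := Nat.le_mul_of_pos_right d hl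
    calc 1 + 2 * (2 * d * (2 * l + 1) + 1) = 3 + 8 * (d * l) + 4 * d := by ring
      _ ≤ 15 * (d * l) := by omega
  calc 2 * ((4 * l + 3) * (1 + 2 * (2 * d * (2 * l + 1) + 1))) * (780 * l ^ 2)
      ≤ 2 * (7 * l * (15 * (d * l))) * (780 * l ^ 2) := by gcongr
    _ = 163800 * d * l ^ 4 := by ring
    _ ≤ 163800 * (d + c) * l ^ 4 := by gcongr; omega

theorem nonempty_coins_equiv (r T b : ℕ) (V : Type) [Fintype V] :
    Nonempty ((Fin (b * 2 * (r * (Fintype.card V * T))) → Bool)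
      ≃ (Fin r × V × Fin T → Fin b × Bool → ZMod 2)) := by
  classical
  refine ⟨Fintype.equivOfCardEq ?_⟩
  simp only [Fintype.card_prod, Fintype.card_fun, Fintype.card_fin, Fintype.card_bool, ZMod.card]
  rw [← pow_mul]

end Congest

theorem theorem6 :
    ∃ a k : ℕ, ∀ β : ℕ, ∃ β' : ℕ,
      ∀ (V : Type) [Fintype V] [DecidableEq V] (G : SimpleGraph V)
        (𝒞 : Finset (Σ v, G.Walk v v)) (d c : ℕ), Congest.IsCycleCover G 𝒞 d c →
      ∃ T : ℕ, T ≤ a * (d + c) * Nat.clog 2 (Fintype.card V) ^ k ∧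
        ∀ r : ℕ, ∃ (m : ℕ) (K : Congest.Compiler G
            (Congest.bandwidth β (Fintype.card V)) (Congest.bandwidth β' (Fintype.card V)) m),
          ∀ (Input Coins Output : V → Type)
            (A : Congest.Algorithm G (Congest.bandwidth β (Fintype.card V))
              (fun v => Input v × Coins v) Output),
            -- the compiled algorithm has the same outputs after `r * T` rounds as `A` after `r`
            (∀ (x : ∀ v, Input v × Coins v) (κ : V → Fin m → Bool) (v : V),
              (K.compile A).result (fun v => (x v, κ v)) (r * T) v = A.result x r v) ∧
            -- the eavesdropper's view has the same law for all inputs and all coins of `A`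
            (∀ (E : Congest.Eavesdropper G (Congest.bandwidth β' (Fintype.card V)))
              (x x' : ∀ v, Input v × Coins v),
              Congest.viewLaw (K.compile A) x E (r * T) =
                Congest.viewLaw (K.compile A) x' E (r * T)) := by
  -- The factor 4 in the bandwidth is that of `exists_coding`.
  refine ⟨163800, 4, fun β => ⟨4 * β, fun V _ _ G 𝒞 d c h𝒞 => ?_⟩⟩
  by_cases hG : ∀ u v, ¬ G.Adj u v
  -- Without edges the bound on `T` may be 0, so all `r` rounds are simulated at initialisation.
  -- Security is vacuous, since an eavesdropper needs a dart.
  · refine ⟨0, Nat.zero_le _, fun r => ⟨0, fun v X Y P => Congest.simulateIsolated r P, ?_⟩⟩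
    intro Input Coins Output A
    refine ⟨fun x κ v => ?_, fun E => ?_⟩
    · rw [Nat.mul_zero]
      exact congrArg (A v).output (Congest.state_of_edgeless hG A x r v).symm
    · exact absurd (E []).adj (hG _ _)
  · push Not at hG
    obtain ⟨u₀, v₀, hadj⟩ := hG
    have hcov : ∀ e ∈ G.edgeSet, ∃ (u : V) (w : G.Walk u u),
        w.IsCycle ∧ w.length ≤ d ∧ e ∈ w.edges := by
      intro e he
      obtain ⟨C, hC⟩ := Finset.card_pos.1 (h𝒞.covers e he)
      obtain ⟨hC, heC⟩ := Finset.mem_filter.1 hC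
      exact ⟨C.1, C.2, h𝒞.isCycle C hC, h𝒞.length_le C hC, heC⟩
    have hd : 1 ≤ d := by
      obtain ⟨u, w, hw, hwd, -⟩ := hcov s(u₀, v₀) hadj
      have := hw.three_le_length
      omega
    have hn : 1 < Fintype.card V := Fintype.one_lt_card_iff.2 ⟨u₀, v₀, hadj.ne⟩
    obtain ⟨l, hl⟩ : ∃ l, l = Nat.clog 2 (Fintype.card V) := ⟨_, rfl⟩
    have hl1 : 1 ≤ l := hl ▸ Nat.clog_pos (by norm_num) hn
    have : Nonempty V := ⟨u₀⟩
    obtain ⟨L, hL, hLcov⟩ := Congest.exists_evenFamily_cover hcov hl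
    obtain ⟨carry, hs⟩ := Congest.exists_schedule hL hLcov
    rw [← hl]
    refine ⟨_, Congest.trail_rounds_le hd hl1 c, fun r => ?_⟩
    have hT : 0 < 2 * ((4 * l + 3) * (1 + 2 * (2 * d * (2 * l + 1) + 1))) * (780 * l ^ 2) := by
      positivity
    generalize 2 * ((4 * l + 3) * (1 + 2 * (2 * d * (2 * l + 1) + 1))) * (780 * l ^ 2) = T at hs hT
    obtain ⟨cd⟩ := Congest.exists_coding (b := Congest.bandwidth β (Fintype.card V))
      (b' := Congest.bandwidth (4 * β) (Fintype.card V))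
      (by rw [Congest.bandwidth, Congest.bandwidth, mul_assoc])
    obtain ⟨rd⟩ := Congest.nonempty_coins_equiv r T (Congest.bandwidth β (Fintype.card V)) V
    refine ⟨_, fun v X Y P => Congest.compileNode cd carry rd v P, ?_⟩
    intro Input Coins Output A
    exact ⟨fun x κ v => Congest.result_compile cd rd A hT hs x κ r v,
      Congest.viewLaw_compileNode_eq cd rd A hT hs⟩
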